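/- Conventions. A map $f$ from an open subset $s$ of a (Hausdorff, real) locally convex space $X$ to a locally convex space $Y$ is smooth if all its iterated directional derivatives $d^nf(x).(v_1,\dots,v_n)$ exist for $x\in s$, $v_i\in X$ and are continuous as maps $d^nf\colon s\times X^n\to Y$ ($n\ge 0$); a map on a set $s$ with dense interior is smooth if it is continuous, is smooth on the interior of $s$, and all the differentials $d^nf$ extend continuously to $s\times X^n$. A locally convex manifold is a Hausdorff space with an atlas of charts onto open subsets of locally convex spaces whose coordinate changes are smooth. A $d$-dimensional manifold with corners is a paracompact Hausdorff space with an atlas of charts onto relatively open subsets of $\{x\in\mathbb R^d: x_i\ge 0 \text{ for all } i\}$ whose coordinate changes are smooth. A continuous map $f\colon M\to N$ from a manifold with corners to a locally convex manifold is smooth on an open set $W\subseteq M$ if all the coordinate representations of $f|_W$ are smooth; it is smooth on a neighbourhood of a set $B$ if it is smooth on some open $W\supseteq B$; and $C^\infty(M,N)$ is the set of those $f \in C(M,N)$ that are smooth on $M$. The graph topology on $C(M,N)$ is the topology with basis the sets $\Gamma_V=\{f\in C(M,N): (x,f(x))\in V\text{ for all }x\in M\}$, where $V\subseteq M\times N$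 is open. Statement. Let $M$ be a finite-dimensional connected manifold with corners and $N$ a locally convex manifold. Let $C(M,N)$ carry either the graph topology or the compact-open topology. Let $f\in C(M,N)$, let $A\subseteq M$ be closed and $U\subseteq M$ be open such that $f$ is smooth on a neighbourhood of $A\setminus U$. Then each open neighbourhood $O$ of $f$ in $C(M,N)$ contains a map $g$ which is smooth on a neighbourhood of $A$, equals $f$ on $M\setminus U$, and is homotopic to $f$ in $O$, i.e. there is a continuous map $F\colon[0,1]\times M\to N$ with $F(0,\cdot)=f$, $F(1,\cdot)=g$ and $F(t,\cdot)\in O$ for all $t\in[0,1]$. In particular, $C^\infty(M,N)$ is dense in $C(M,N)$. All of this holds for each of the two topologies. -/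

import Mathlib

open Set Filter Topology
open scoped Manifold ContDiff

universe uM uN uI uE

/-- Smoothness (in the sense of Michal--Bastiani, i.e. `C^∞_c`) of a map `f` between real
topological vector spaces on a set `s` that is open or, more generally, has dense interior.
`D n x (v₁, …, vₙ)` is the iterated directional derivative `dⁿf(x).(v₁, …, vₙ)`: on the interior
of `s` each `D (n + 1)` is the limit of the difference quotients of `D n`, and every `D n` is
jointly continuous on the whole of `s × Xⁿ`. If `s` is open, this says that all the `dⁿf` exist and
are continuous on `s × Xⁿ`; in general it says that `f` is continuous on `s`, smooth on the interior
of `s`, and that all the differentials extend continuously to `s`. -/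
def IsSmoothOn {X Y : Type*}
    [AddCommGroup X] [Module ℝ X] [TopologicalSpace X]
    [AddCommGroup Y] [Module ℝ Y] [TopologicalSpace Y]
    (f : X → Y) (s : Set X) : Prop :=
  ∃ D : (n : ℕ) → X → (Fin n → X) → Y,
    (∀ x ∈ s, ∀ v : Fin 0 → X, D 0 x v = f x) ∧
    (∀ n : ℕ, ContinuousOn (fun p : X × (Fin n → X) => D n p.1 p.2) (s ×ˢ univ)) ∧
    (∀ n : ℕ, ∀ x ∈ interior s, ∀ (v : Fin n → X) (w : X),
      Tendsto (fun h : ℝ => h⁻¹ • (D n (x + h • w) v - D n x v)) (𝓝[≠] 0)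
        (𝓝 (D (n + 1) x (Fin.snoc (α := fun _ => X) v w))))

set_option linter.checkUnivs false in
/-- A smooth atlas on a topological space `N` with charts onto open subsets of (Hausdorff, real)
locally convex spaces. The model space may vary from chart to chart. A locally convex manifold is a
Hausdorff space together with such an atlas. -/
structure LocallyConvexAtlas (N : Type uN) [TopologicalSpace N] where
  /-- the index set of the charts -/
  Index : Type uI
  /-- the model space of a chart -/
  Model : Index → Type uE
  [addCommGroup : ∀ i, AddCommGroup (Model i)]
  [module : ∀ i, Module ℝ (Model i)]
  [topologicalSpace : ∀ i, TopologicalSpace (Model i)]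
  [isTopologicalAddGroup : ∀ i, IsTopologicalAddGroup (Model i)]
  [continuousSMul : ∀ i, ContinuousSMul ℝ (Model i)]
  [locallyConvexSpace : ∀ i, LocallyConvexSpace ℝ (Model i)]
  [t2Space : ∀ i, T2Space (Model i)]
  /-- the charts: homeomorphisms from open subsets of `N` onto open subsets of the model spaces -/
  chart : ∀ i, OpenPartialHomeomorph N (Model i)
  /-- the charts cover `N` -/
  exists_mem_source : ∀ x : N, ∃ i, x ∈ (chart i).source
  /-- the coordinate changes are smooth -/
  compatible : ∀ i j,
    IsSmoothOn (fun y => chart j ((chart i).symm y)) ((chart i).symm.trans (chart j)).source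

attribute [instance] LocallyConvexAtlas.addCommGroup LocallyConvexAtlas.module
  LocallyConvexAtlas.topologicalSpace LocallyConvexAtlas.isTopologicalAddGroup
  LocallyConvexAtlas.continuousSMul LocallyConvexAtlas.locallyConvexSpace
  LocallyConvexAtlas.t2Space

section

variable {M : Type uM} [TopologicalSpace M] {N : Type uN} [TopologicalSpace N]

/-- The map `f` from the `d`-dimensional manifold with corners `M` to the locally convex manifold
`N` (with atlas `𝒜`) is smooth on the open set `W ⊆ M`: all its coordinate representations are
smooth. They are defined on relatively open subsets of the quadrant
`{y ∈ ℝ^d | ∀ i, 0 ≤ y i}`, and these have dense interior. -/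
def SmoothOnOpen (d : ℕ) [ChartedSpace (EuclideanQuadrant d) M]
    (𝒜 : LocallyConvexAtlas.{uN, uI, uE} N) (f : C(M, N)) (W : Set M) : Prop :=
  ∀ φ ∈ atlas (EuclideanQuadrant d) M, ∀ i : 𝒜.Index,
    IsSmoothOn
      (fun y : EuclideanSpace ℝ (Fin d) =>
        𝒜.chart i (f ((φ.extend (modelWithCornersEuclideanQuadrant d)).symm y)))
      ((φ.extend (modelWithCornersEuclideanQuadrant d)).target ∩
        (φ.extend (modelWithCornersEuclideanQuadrant d)).symm ⁻¹'
          (W ∩ f ⁻¹' (𝒜.chart i).source))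

/-- `f` is smooth on a neighbourhood of the set `A`. -/
def SmoothNear (d : ℕ) [ChartedSpace (EuclideanQuadrant d) M]
    (𝒜 : LocallyConvexAtlas.{uN, uI, uE} N) (f : C(M, N)) (A : Set M) : Prop :=
  ∃ W : Set M, IsOpen W ∧ A ⊆ W ∧ SmoothOnOpen d 𝒜 f W

/-- The set `C^∞(M, N)` of smooth maps inside `C(M, N)`. -/
def smoothMaps (d : ℕ) [ChartedSpace (EuclideanQuadrant d) M]
    (𝒜 : LocallyConvexAtlas.{uN, uI, uE} N) : Set C(M, N) :=
  {g | SmoothOnOpen d 𝒜 g univ}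

variable (M N) in
/-- The graph topology on `C(M, N)`, generated by the sets `{f | graph of f ⊆ V}` with
`V ⊆ M × N` open; these sets are closed under finite intersections. -/
abbrev graphTopology : TopologicalSpace C(M, N) :=
  TopologicalSpace.generateFrom
    {S | ∃ V : Set (M × N), IsOpen V ∧ S = {f : C(M, N) | ∀ x : M, (x, f x) ∈ V}}

end

/-!
The compact-open topology is coarser than the graph topology (`graphTopology_le_compactOpen`), and
density of the smooth maps is the case `A = U = M`, so it suffices to approximate in the graph
topology. There an open set contains, with `f`, all maps whose graph lies in some open neighbourhood
`V` of the graph of `f`.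

Let `f` be smooth on an open set `W ⊇ A \ U`. Then `B = A \ W` is closed and contained in `U`. A
connected paracompact locally compact space is σ-compact, so `B` is covered by the interiors of
countably many compact sets `Cₐ ⊆ Qₐ ⊆ U`, with the `Qₐ` open, relatively compact and locally finite,
and `f` maps the closure of `Qₐ` into the domain of one chart of `N`
(`exists_countable_adapted_cover`). The last condition is open in the graph topology, and it is made
part of `V`. The map is now changed on one `Qₐ` at a time (`exists_smoothing_step`): in the chart, `f`
is moved along a line segment to `(1 - ∑ μₖ) f + ∑ μₖ cₖ` with values `cₖ` of `f` and finitely many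
smooth functions `μₖ` supported in `Qₐ` with sum `1` on `Cₐ`. For a fine enough partition the segment
stays in `V`, by local convexity of the model space and compactness. The new map is smooth on the
interior of `Cₐ`, and no smoothness is lost elsewhere. The countably many homotopies are performed
in successive subintervals of `[0, 1)`; by local finiteness the concatenation is locally stationary
before the time `1` (`exists_smoothing_homotopy`).

The new map is smooth in the other charts of `N` by the chain rule, which has to be proved for
maps from a set with dense interior in `ℝ^d` to locally convex spaces. The mean value
theorem, obtained from the Hahn–Banach theorem, gives difference quotients along moving base points
and directions (`tendsto_slope_of_hasDirDeriv`), hence the multilinearity of the differentials and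
their derivative along curves (`IsDifferentials.tendsto_slope_curve`). A function on a subset of
`ℝ^d` is smooth as soon as it belongs to a set of continuous functions that is closed under partial
derivatives (`IsSmoothFamily.isSmoothOn`). This is how products and compositions are treated: the
span of the functions `x ↦ Dⁿg(f x)(u₁ x, …, uₙ x)`, with `uⱼ` iterated partial derivatives of `f`,
is such a set (`IsSmoothFamily.comp`).
-/

set_option linter.unusedSectionVars false

/-! ### Directional derivatives in locally convex spaces -/

section DirectionalDerivative

variable {X Y : Type*} [AddCommGroup X] [Module ℝ X] [TopologicalSpace X]
  [AddCommGroup Y] [Module ℝ Y] [TopologicalSpace Y]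

/-- `y` is the derivative of `f` at `x` in the direction `w`. -/
def HasDirDeriv (f : X → Y) (x w : X) (y : Y) : Prop :=
  Tendsto (fun h : ℝ => h⁻¹ • (f (x + h • w) - f x)) (𝓝[≠] 0) (𝓝 y)

/-- The maps `D n` are iterated differentials of `f` on `s`, extended continuously from the
interior of `s`; the body of `IsSmoothOn`. -/
structure IsDifferentials (f : X → Y) (s : Set X) (D : (n : ℕ) → X → (Fin n → X) → Y) :
    Prop where
  zero : ∀ x ∈ s, ∀ v : Fin 0 → X, D 0 x v = f x
  cont : ∀ n : ℕ, ContinuousOn (fun p : X × (Fin n → X) => D n p.1 p.2) (s ×ˢ univ)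
  deriv : ∀ n : ℕ, ∀ x ∈ interior s, ∀ (v : Fin n → X) (w : X),
    HasDirDeriv (fun y => D n y v) x w (D (n + 1) x (Fin.snoc (α := fun _ => X) v w))

lemma isSmoothOn_iff {f : X → Y} {s : Set X} : IsSmoothOn f s ↔ ∃ D, IsDifferentials f s D :=
  ⟨fun ⟨D, h0, hc, hd⟩ => ⟨D, h0, hc, hd⟩, fun ⟨D, h⟩ => ⟨D, h.zero, h.cont, h.deriv⟩⟩

lemma HasDirDeriv.unique [T2Space Y] {f : X → Y} {x w : X} {y z : Y}
    (h : HasDirDeriv f x w y) (h' : HasDirDeriv f x w z) : y = z :=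
  tendsto_nhds_unique h h'

lemma HasDirDeriv.smul_dir [ContinuousSMul ℝ Y] {f : X → Y} {x w : X} {y : Y}
    (h : HasDirDeriv f x w y) (c : ℝ) : HasDirDeriv f x (c • w) (c • y) := by
  unfold HasDirDeriv at *
  rcases eq_or_ne c 0 with rfl | hc
  · simpa using tendsto_const_nhds
  · have hm : Tendsto (fun k : ℝ => k * c) (𝓝[≠] 0) (𝓝[≠] 0) := by
      refine tendsto_nhdsWithin_iff.2 ⟨?_, ?_⟩
      · exact (Continuous.tendsto' (by fun_prop) 0 0 (by simp)).mono_left nhdsWithin_le_nhds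
      · filter_upwards [self_mem_nhdsWithin] with k hk
        exact mul_ne_zero hk hc
    refine ((h.comp hm).const_smul c).congr fun k => ?_
    simp only [Function.comp, smul_smul, mul_inv, mul_comm k⁻¹ c⁻¹]
    rw [← mul_assoc, mul_inv_cancel₀ hc, one_mul]

lemma tendsto_add_smul [ContinuousAdd X] [ContinuousSMul ℝ X] (x w : X) :
    Tendsto (fun h : ℝ => x + h • w) (𝓝 0) (𝓝 x) := by
  have : Continuous fun h : ℝ => x + h • w := by fun_prop
  simpa using this.tendsto 0

lemma eventually_add_smul_mem [ContinuousAdd X] [ContinuousSMul ℝ X] {s : Set X} (hs : IsOpen s)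
    {x : X} (hx : x ∈ s) (w : X) : ∀ᶠ h : ℝ in 𝓝[≠] 0, x + h • w ∈ s :=
  ((tendsto_add_smul x w).mono_left nhdsWithin_le_nhds).eventually (hs.mem_nhds hx)

lemma HasDirDeriv.congr_on [ContinuousAdd X] [ContinuousSMul ℝ X] {f g : X → Y} {s : Set X}
    (hs : IsOpen s) (hfg : EqOn f g s) {x : X} (hx : x ∈ s) {w : X} {y : Y}
    (h : HasDirDeriv f x w y) : HasDirDeriv g x w y := by
  refine Tendsto.congr' ?_ h
  filter_upwards [eventually_add_smul_mem hs hx w] with k hk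
  rw [hfg hk, hfg hx]

/-- Mean value theorem. A point outside the closed convex set `C` is separated from `C` by a
continuous linear functional, which reduces the claim to real functions. -/
lemma sub_mem_of_hasDirDeriv_mem [IsTopologicalAddGroup Y] [ContinuousSMul ℝ Y]
    [LocallyConvexSpace ℝ Y] {G : X → Y} {p w : X} {C : Set Y} (hC : Convex ℝ C)
    (hC' : IsClosed C)
    (h : ∀ t ∈ Icc (0 : ℝ) 1, ∃ z ∈ C, HasDirDeriv G (p + t • w) w z) :
    G (p + w) - G p ∈ C := by
  by_contra hn
  obtain ⟨l, u, hl, hu⟩ := geometric_hahn_banach_closed_point hC hC' hn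
  choose! z hzC hz using h
  have hd : ∀ t ∈ Icc (0 : ℝ) 1, HasDerivAt (fun t => l (G (p + t • w))) (l (z t)) t := by
    intro t ht
    rw [hasDerivAt_iff_tendsto_slope_zero]
    refine ((l.continuous.tendsto _).comp (hz t ht)).congr fun k => ?_
    simp [add_smul, add_assoc]
  obtain ⟨t, ht, heq⟩ := exists_hasDerivAt_eq_slope (fun t : ℝ => l (G (p + t • w)))
    (fun t => l (z t)) zero_lt_one (fun t ht => (hd t ht).continuousAt.continuousWithinAt)
    (fun t ht => hd t (Ioo_subset_Icc_self ht))
  have h1 := hl _ (hzC t (Ioo_subset_Icc_self ht))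
  simp at heq hu
  linarith

lemma exists_closed_convex_nhds [IsTopologicalAddGroup Y] [ContinuousSMul ℝ Y]
    [LocallyConvexSpace ℝ Y] {y : Y} {U : Set Y} (hU : U ∈ 𝓝 y) :
    ∃ C ∈ 𝓝 y, Convex ℝ C ∧ IsClosed C ∧ C ⊆ U := by
  obtain ⟨F, hF, hFc, hFU⟩ := exists_mem_nhds_isClosed_subset hU
  obtain ⟨C, ⟨hC, hCc⟩, hCF⟩ := (LocallyConvexSpace.convex_basis (𝕜 := ℝ) y).mem_iff.1 hF
  exact ⟨closure C, mem_of_superset hC subset_closure, hCc.closure, isClosed_closure,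
    (closure_minimal hCF hFc).trans hFU⟩

/-- If the directional derivatives `G' p w` are continuous in `(p, w)`, then difference quotients
of `G` may be computed along moving base points and moving directions. -/
lemma tendsto_slope_of_hasDirDeriv [ContinuousAdd X] [ContinuousSMul ℝ X]
    [IsTopologicalAddGroup Y] [ContinuousSMul ℝ Y] [LocallyConvexSpace ℝ Y]
    {G : X → Y} {G' : X → X → Y} {S : Set X} (hS : IsOpen S)
    (hG : ∀ p ∈ S, ∀ w, HasDirDeriv G p w (G' p w)) {x w : X} (hx : x ∈ S)
    (hcont : ContinuousAt (fun p : X × X => G' p.1 p.2) (x, w)) {p q : ℝ → X}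
    (hp : Tendsto p (𝓝[≠] 0) (𝓝 x)) (hq : Tendsto q (𝓝[≠] 0) (𝓝 w)) :
    Tendsto (fun h : ℝ => h⁻¹ • (G (p h + h • q h) - G (p h))) (𝓝[≠] 0) (𝓝 (G' x w)) := by
  rw [tendsto_iff_forall_eventually_mem]
  intro U hU
  obtain ⟨C, hC, hCc, hCl, hCU⟩ := exists_closed_convex_nhds hU
  have hlim : Tendsto (fun a : ℝ × ℝ => (p a.2 + a.1 • q a.2, q a.2)) (𝓝 0 ×ˢ 𝓝[≠] 0)
      (𝓝 (x, w)) := by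
    rw [nhds_prod_eq]
    have hq' := hq.comp (tendsto_snd (f := 𝓝 (0 : ℝ)))
    refine Tendsto.prodMk ?_ hq'
    simpa using (hp.comp (tendsto_snd (f := 𝓝 (0 : ℝ)))).add
      ((tendsto_fst (g := 𝓝[≠] (0 : ℝ))).smul hq')
  have hev : ∀ᶠ b : X × X in 𝓝 (x, w), b.1 ∈ S ∧ G' b.1 b.2 ∈ C :=
    (continuous_fst.continuousAt.eventually (hS.mem_nhds hx)).and (hcont.eventually hC)
  obtain ⟨pa, hpa, pb, hpb, hab⟩ := eventually_prod_iff.1 (hlim.eventually hev)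
  obtain ⟨ε, hε, hball⟩ := Metric.eventually_nhds_iff.1 hpa
  have hsmall : ∀ᶠ h : ℝ in 𝓝[≠] 0, dist h 0 < ε :=
    nhdsWithin_le_nhds (Metric.ball_mem_nhds 0 hε)
  filter_upwards [hpb, hsmall, self_mem_nhdsWithin] with h hh hhε hh0
  have hh0 : h ≠ 0 := hh0
  apply hCU
  have key : G (p h + h • q h) - G (p h) ∈ (fun y : Y => h⁻¹ • y) ⁻¹' C := by
    refine sub_mem_of_hasDirDeriv_mem ?_ (hCl.preimage (continuous_const_smul _)) ?_
    · exact hCc.is_linear_preimage (IsLinearMap.isLinearMap_smul _)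
    · intro t ht
      have hth : dist (t * h) 0 < ε := by
        rw [Real.dist_eq, sub_zero] at *
        rw [abs_mul, abs_of_nonneg ht.1]
        nlinarith [abs_nonneg h, ht.2]
      have h2 := hab (hball hth) hh
      rw [mul_smul] at h2
      exact ⟨h • G' (p h + t • h • q h) (q h), by simpa [smul_smul, hh0] using h2.2,
        (hG _ h2.1 _).smul_dir h⟩
  exact key

end DirectionalDerivative

/-! ### Algebra of iterated differentials -/

section Differentials

variable {X Y : Type*} [AddCommGroup X] [Module ℝ X] [TopologicalSpace X]
  [IsTopologicalAddGroup X] [ContinuousSMul ℝ X]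
  [AddCommGroup Y] [Module ℝ Y] [TopologicalSpace Y]
  {f : X → Y} {s : Set X} {D : (n : ℕ) → X → (Fin n → X) → Y}

namespace IsDifferentials

lemma continuousOn (h : IsDifferentials f s D) (n : ℕ) (v : Fin n → X) :
    ContinuousOn (fun x => D n x v) s :=
  (h.cont n).comp (f := fun x => (x, v)) (by fun_prop) fun _ hx => ⟨hx, mem_univ _⟩

lemma continuousAt (h : IsDifferentials f s D) (n : ℕ) {x : X} (hx : x ∈ interior s)
    (v : Fin n → X) : ContinuousAt (fun p : X × (Fin n → X) => D n p.1 p.2) (x, v) :=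
  (h.cont n).continuousAt (prod_mem_nhds (mem_interior_iff_mem_nhds.1 hx) univ_mem)

lemma continuousAt_snoc (h : IsDifferentials f s D) (n : ℕ) {x : X} (hx : x ∈ interior s)
    (v : Fin n → X) (w : X) :
    ContinuousAt (fun p : X × X => D (n + 1) p.1 (Fin.snoc (α := fun _ => X) v p.2)) (x, w) := by
  have hc : Continuous fun p : X × X => (p.1, Fin.snoc (α := fun _ => X) v p.2) :=
    continuous_fst.prodMk (Continuous.finSnoc continuous_const continuous_snd)
  exact ContinuousAt.comp_of_eq (h.continuousAt (n + 1) hx _) hc.continuousAt rfl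

variable [IsTopologicalAddGroup Y] [ContinuousSMul ℝ Y] [LocallyConvexSpace ℝ Y]

lemma tendsto_slope (h : IsDifferentials f s D) (n : ℕ) (v : Fin n → X) {x w : X}
    (hx : x ∈ interior s) {p q : ℝ → X}
    (hp : Tendsto p (𝓝[≠] 0) (𝓝 x)) (hq : Tendsto q (𝓝[≠] 0) (𝓝 w)) :
    Tendsto (fun h : ℝ => h⁻¹ • (D n (p h + h • q h) v - D n (p h) v)) (𝓝[≠] 0)
      (𝓝 (D (n + 1) x (Fin.snoc (α := fun _ => X) v w))) :=
  tendsto_slope_of_hasDirDeriv isOpen_interior (G := fun y => D n y v)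
    (G' := fun y w => D (n + 1) y (Fin.snoc (α := fun _ => X) v w))
    (fun p hp w => h.deriv n p hp v w) hx (h.continuousAt_snoc n hx v w) hp hq

variable [T2Space Y]

/-- Linearity in the last direction is additivity of the directional derivative; in the other
directions it is inherited from `D n` by passing to the limit. -/
lemma map_update (h : IsDifferentials f s D) (n : ℕ) {x : X} (hx : x ∈ interior s)
    (v : Fin n → X) (j : Fin n) (a b : X) (c : ℝ) :
    D n x (Function.update v j (a + c • b)) =
      D n x (Function.update v j a) + c • D n x (Function.update v j b) := by
  induction n generalizing x with
  | zero => exact j.elim0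
  | succ n ih =>
    rw [← Fin.snoc_init_self v]
    induction j using Fin.lastCases with
    | last =>
      simp only [Fin.update_snoc_last]
      have h1 := h.tendsto_slope n (Fin.init v) (w := c • b) hx (p := fun t => x + t • a)
        ((tendsto_add_smul x a).mono_left nhdsWithin_le_nhds) tendsto_const_nhds
      have h2 := h.deriv n x hx (Fin.init v) a
      have h3 := h.deriv n x hx (Fin.init v) (a + c • b)
      have h4 := (h.deriv n x hx (Fin.init v) b).smul_dir c
      rw [h4.unique (h.deriv n x hx (Fin.init v) (c • b))]
      refine h3.unique ((h2.add h1).congr fun t => ?_)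
      rw [← smul_add, smul_add t, ← add_assoc]
      congr 1
      abel
    | cast j =>
      simp only [← Fin.snoc_update]
      set w := v (Fin.last n)
      have h1 := (h.deriv n x hx (Function.update (Fin.init v) j a) w).add
        ((h.deriv n x hx (Function.update (Fin.init v) j b) w).const_smul c)
      refine (h.deriv n x hx (Function.update (Fin.init v) j (a + c • b)) w).unique
        (h1.congr' ?_)
      filter_upwards [eventually_add_smul_mem isOpen_interior hx w] with t ht
      rw [ih ht, ih hx, smul_comm c, ← smul_add, smul_sub c]
      congr 1
      abel

lemma map_update_zero (h : IsDifferentials f s D) (n : ℕ) {x : X} (hx : x ∈ interior s)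
    (v : Fin n → X) (j : Fin n) : D n x (Function.update v j 0) = 0 := by
  have := h.map_update n hx v j 0 0 (-1)
  simpa using this

/-- The differential at an interior point as a multilinear map. -/
def toMultilinearMap (h : IsDifferentials f s D) (n : ℕ) {x : X} (hx : x ∈ interior s) :
    MultilinearMap ℝ (fun _ : Fin n => X) Y :=
  MultilinearMap.mk' (D n x)
    (fun v j a b => by simpa using h.map_update n hx v j a b 1)
    (fun v j c b => by simpa [h.map_update_zero n hx] using h.map_update n hx v j 0 b c)

@[simp] lemma toMultilinearMap_apply (h : IsDifferentials f s D) (n : ℕ) {x : X}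
    (hx : x ∈ interior s) (v : Fin n → X) : h.toMultilinearMap n hx v = D n x v := rfl

lemma map_update_sum (h : IsDifferentials f s D) (n : ℕ) {x : X} (hx : x ∈ interior s)
    {ι : Type*} (t : Finset ι) (c : ι → ℝ) (a : ι → X) (v : Fin n → X) (j : Fin n) :
    D n x (Function.update v j (∑ i ∈ t, c i • a i)) =
      ∑ i ∈ t, c i • D n x (Function.update v j (a i)) := by
  have := (h.toMultilinearMap n hx).map_update_sum t j (fun i => c i • a i) v
  simpa only [MultilinearMap.map_update_smul, toMultilinearMap_apply] using this

lemma map_snoc_sum (h : IsDifferentials f s D) (n : ℕ) {x : X} (hx : x ∈ interior s)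
    {ι : Type*} (t : Finset ι) (c : ι → ℝ) (a : ι → X) (v : Fin n → X) :
    D (n + 1) x (Fin.snoc (α := fun _ => X) v (∑ i ∈ t, c i • a i)) =
      ∑ i ∈ t, c i • D (n + 1) x (Fin.snoc (α := fun _ => X) v (a i)) := by
  have := h.map_update_sum (n + 1) hx t c a (Fin.snoc (α := fun _ => X) v 0) (Fin.last n)
  simpa only [Fin.update_snoc_last] using this

/-- Derivative of `D n` along a curve in all its arguments. -/
lemma tendsto_slope_curve (h : IsDifferentials f s D) (n : ℕ) {x x' : X} (hx : x ∈ interior s)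
    {q : ℝ → X} (hq : Tendsto q (𝓝[≠] 0) (𝓝 x')) {u : ℝ → Fin n → X} {u₀ u' : Fin n → X}
    (hu : ∀ j, Tendsto (fun k => k⁻¹ • (u k j - u₀ j)) (𝓝[≠] 0) (𝓝 (u' j))) :
    Tendsto (fun k : ℝ => k⁻¹ • (D n (x + k • q k) (u k) - D n x u₀)) (𝓝[≠] 0)
      (𝓝 (D (n + 1) x (Fin.snoc (α := fun _ => X) u₀ x') +
        ∑ j, D n x (Function.update u₀ j (u' j)))) := by
  classical
  have hk0 : Tendsto (fun k : ℝ => k) (𝓝[≠] 0) (𝓝 0) := nhdsWithin_le_nhds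
  have hxk : Tendsto (fun k : ℝ => x + k • q k) (𝓝[≠] 0) (𝓝 x) := by
    simpa using tendsto_const_nhds.add (hk0.smul hq)
  have huk : ∀ j, Tendsto (fun k => u k j) (𝓝[≠] 0) (𝓝 (u₀ j)) := by
    intro j
    have : Tendsto (fun k : ℝ => u₀ j + k • (k⁻¹ • (u k j - u₀ j))) (𝓝[≠] 0) (𝓝 (u₀ j)) := by
      simpa using tendsto_const_nhds.add (hk0.smul (hu j))
    refine this.congr' ?_
    filter_upwards [self_mem_nhdsWithin] with k hk
    have hk : k ≠ 0 := hk
    simp [smul_smul, hk]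
  -- The arguments are moved from `u₀` to `u k` one at a time.
  have key : ∀ t : Finset (Fin n), Tendsto
      (fun k : ℝ => k⁻¹ • (D n (x + k • q k) (t.piecewise (u k) u₀) - D n x u₀)) (𝓝[≠] 0)
      (𝓝 (D (n + 1) x (Fin.snoc (α := fun _ => X) u₀ x') +
        ∑ j ∈ t, D n x (Function.update u₀ j (u' j)))) := by
    intro t
    induction t using Finset.induction with
    | empty => simpa using h.tendsto_slope n u₀ hx (p := fun _ => x) tendsto_const_nhds hq
    | insert j t hj ih =>
      rw [Finset.sum_insert hj, add_comm (D n x _), ← add_assoc]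
      have hpt : Tendsto (fun k => (x + k • q k, Function.update (t.piecewise (u k) u₀) j
          (k⁻¹ • (u k j - u₀ j)))) (𝓝[≠] 0) (𝓝 (x, Function.update u₀ j (u' j))) := by
        rw [nhds_prod_eq]
        refine hxk.prodMk (tendsto_pi_nhds.2 fun i => ?_)
        rcases eq_or_ne i j with rfl | hij
        · simpa using hu i
        · by_cases hi : i ∈ t
          · simpa [hij, hi] using huk i
          · simpa [hij, hi] using tendsto_const_nhds
      refine (ih.add ((h.continuousAt n hx _).tendsto.comp hpt)).congr' ?_
      filter_upwards [hxk.eventually (isOpen_interior.mem_nhds hx)] with k hk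
      have hk : x + k • q k ∈ interior s := hk
      have h1 := h.map_update n hk (t.piecewise (u k) u₀) j (u k j) (u₀ j) (-1)
      have h2 := (h.toMultilinearMap n hk).map_update_smul (t.piecewise (u k) u₀) j k⁻¹
        (u k j - u₀ j)
      have h3 : Function.update (t.piecewise (u k) u₀) j (u₀ j) = t.piecewise (u k) u₀ := by
        rw [Function.update_eq_self_iff]
        simp [hj]
      simp only [toMultilinearMap_apply] at h2
      rw [Function.comp_apply]
      rw [Finset.piecewise_insert, h2, ← smul_add]
      rw [neg_one_smul, ← sub_eq_add_neg, h3] at h1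
      rw [h1]
      congr 1
      simp only [neg_smul, one_smul]
      abel
  simpa using key Finset.univ

end IsDifferentials

end Differentials

/-! ### Families of functions closed under partial derivatives -/

section Families

variable {d : ℕ} {Y Z : Type*}
  [AddCommGroup Y] [Module ℝ Y] [TopologicalSpace Y]
  [AddCommGroup Z] [Module ℝ Z] [TopologicalSpace Z]

/-- `F` is continuous on `s`, and has directional derivatives in the interior of `s` which are
linear in the direction and whose coefficients, the partial derivatives, are members of `𝓖`. -/
def PartialsIn (s : Set (EuclideanSpace ℝ (Fin d))) (𝓖 : Set (EuclideanSpace ℝ (Fin d) → Z))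
    (F : EuclideanSpace ℝ (Fin d) → Z) : Prop :=
  ContinuousOn F s ∧ ∃ G : Fin d → EuclideanSpace ℝ (Fin d) → Z, (∀ i, G i ∈ 𝓖) ∧
    ∀ x ∈ interior s, ∀ w, HasDirDeriv F x w (∑ i, w i • G i x)

/-- The set `𝓕` of functions is closed under partial derivatives. Its members are then smooth,
see `IsSmoothFamily.isSmoothOn`. -/
def IsSmoothFamily (s : Set (EuclideanSpace ℝ (Fin d)))
    (𝓕 : Set (EuclideanSpace ℝ (Fin d) → Z)) : Prop :=
  ∀ F ∈ 𝓕, PartialsIn s 𝓕 F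

/-- Iterated partial derivatives of `F`, for a given choice `δ` of first partial derivatives. -/
def iteratedPartial {α : Type*} (δ : α → Fin d → α) (F : α) : (n : ℕ) → (Fin n → Fin d) → α
  | 0, _ => F
  | n + 1, I => δ (iteratedPartial δ F n (Fin.init I)) (I (Fin.last n))

lemma euclideanSpace_eq_sum (w : EuclideanSpace ℝ (Fin d)) :
    w = ∑ i, w i • EuclideanSpace.single i (1 : ℝ) := by
  ext j
  simp [Pi.single_apply]

/-- The differentials are recovered from the partial derivatives by
`dⁿF(x).(v₁, …, vₙ) = ∑ v₁(i₁) ⋯ vₙ(iₙ) ∂_{iₙ} ⋯ ∂_{i₁} F(x)`. -/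
lemma IsSmoothFamily.isSmoothOn [IsTopologicalAddGroup Z] [ContinuousSMul ℝ Z]
    {s : Set (EuclideanSpace ℝ (Fin d))} {𝓕 : Set (EuclideanSpace ℝ (Fin d) → Z)}
    (h : IsSmoothFamily s 𝓕) {F : EuclideanSpace ℝ (Fin d) → Z} (hF : F ∈ 𝓕) :
    IsSmoothOn F s := by
  choose hcont G hG𝓕 hG using h
  let δ : 𝓕 → Fin d → 𝓕 := fun F i => ⟨G F F.2 i, hG𝓕 F F.2 i⟩
  let P := iteratedPartial δ ⟨F, hF⟩
  refine isSmoothOn_iff.2 ⟨fun n x v => ∑ I : Fin n → Fin d, (∏ k, v k (I k)) • (P n I).1 x,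
    fun x hx v => ?_, fun n => ?_, fun n x hx v w => ?_⟩
  · simp [P, iteratedPartial]
  · refine continuousOn_finsetSum _ fun I _ => ContinuousOn.smul ?_ ?_
    · fun_prop
    · exact (hcont _ (P n I).2).comp continuousOn_fst fun p hp => hp.1
  · have h1 : ∀ I : Fin n → Fin d,
        HasDirDeriv (P n I).1 x w (∑ i, w i • (δ (P n I) i).1 x) := fun I =>
      hG _ (P n I).2 x hx w
    have h2 := tendsto_finsetSum Finset.univ fun I (_ : I ∈ Finset.univ) =>
      (h1 I).const_smul (∏ k, v k (I k))
    have h3 : ∑ I : Fin (n + 1) → Fin d,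
        (∏ k, (Fin.snoc (α := fun _ => EuclideanSpace ℝ (Fin d)) v w : Fin (n + 1) → _) k (I k)) •
          (P (n + 1) I).1 x =
        ∑ I : Fin n → Fin d, (∏ k, v k (I k)) • ∑ i, w i • (δ (P n I) i).1 x := by
      rw [← (Fin.snocEquiv (fun _ : Fin (n + 1) => Fin d)).sum_comp, Fintype.sum_prod_type_right]
      refine Finset.sum_congr rfl fun I _ => ?_
      rw [Finset.smul_sum]
      refine Finset.sum_congr rfl fun i _ => ?_
      rw [Fin.prod_univ_castSucc, smul_smul]
      simp [Fin.snocEquiv, P, iteratedPartial]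
    unfold HasDirDeriv
    rw [h3]
    refine h2.congr fun k => ?_
    rw [← Finset.sum_sub_distrib, Finset.smul_sum]
    refine Finset.sum_congr rfl fun I _ => ?_
    rw [smul_comm, smul_sub]

/-- If the partial derivatives of the members of `𝓖` lie in the span of `𝓖`, then the span is closed
under partial derivatives. -/
lemma IsSmoothFamily.span [IsTopologicalAddGroup Z] [ContinuousSMul ℝ Z]
    {s : Set (EuclideanSpace ℝ (Fin d))} {𝓖 : Set (EuclideanSpace ℝ (Fin d) → Z)}
    (h : ∀ F ∈ 𝓖, PartialsIn s (Submodule.span ℝ 𝓖) F) :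
    IsSmoothFamily s (Submodule.span ℝ 𝓖 : Set (EuclideanSpace ℝ (Fin d) → Z)) := by
  intro F hF
  induction hF using Submodule.span_induction with
  | mem F hF => exact h F hF
  | zero =>
    refine ⟨continuousOn_const, 0, fun i => Submodule.zero_mem _, fun x _ w => ?_⟩
    simpa [HasDirDeriv] using tendsto_const_nhds
  | add F F' _ _ hF hF' =>
    obtain ⟨hc, G, hG, hd⟩ := hF
    obtain ⟨hc', G', hG', hd'⟩ := hF'
    refine ⟨hc.add hc', G + G', fun i => Submodule.add_mem _ (hG i) (hG' i), fun x hx w => ?_⟩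
    simp only [Pi.add_apply, smul_add, Finset.sum_add_distrib]
    refine ((hd x hx w).add (hd' x hx w)).congr fun k => ?_
    simp only [Pi.add_apply]
    rw [← smul_add]
    congr 1
    abel
  | smul c F _ hF =>
    obtain ⟨hc, G, hG, hd⟩ := hF
    refine ⟨hc.const_smul c, c • G, fun i => Submodule.smul_mem _ c (hG i), fun x hx w => ?_⟩
    simp only [Pi.smul_apply, smul_comm _ c, ← Finset.smul_sum]
    refine ((hd x hx w).const_smul c).congr fun k => ?_
    simp only [Pi.smul_apply]
    rw [smul_comm, smul_sub]

/-- The iterated partial derivatives of a smooth function form a smooth family. -/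
lemma IsDifferentials.isSmoothFamily [IsTopologicalAddGroup Y] [ContinuousSMul ℝ Y]
    [LocallyConvexSpace ℝ Y] [T2Space Y] {f : EuclideanSpace ℝ (Fin d) → Y}
    {s : Set (EuclideanSpace ℝ (Fin d))} {D} (h : IsDifferentials f s D) :
    IsSmoothFamily s {F | ∃ n v, F = fun x => D n x v} := by
  rintro _ ⟨n, v, rfl⟩
  refine ⟨h.continuousOn n v,
    fun i x => D (n + 1) x (Fin.snoc (α := fun _ => EuclideanSpace ℝ (Fin d)) v
      (EuclideanSpace.single i 1)), fun i => ⟨n + 1, _, rfl⟩, fun x hx w => ?_⟩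
  rw [← h.map_snoc_sum n hx, ← euclideanSpace_eq_sum]
  exact h.deriv n x hx v w

lemma isSmoothFamily_contDiffOn {s : Set (EuclideanSpace ℝ (Fin d))} (hs : UniqueDiffOn ℝ s) :
    IsSmoothFamily s {a : EuclideanSpace ℝ (Fin d) → ℝ | ContDiffOn ℝ ∞ a s} := by
  intro a ha
  refine ⟨ha.continuousOn, fun i x => fderivWithin ℝ a s x (EuclideanSpace.single i 1),
    fun i => ?_, fun x hx w => ?_⟩
  · exact (ha.fderivWithin hs (m := ∞) (by simp)).clm_apply contDiffOn_const
  · have hx' : s ∈ 𝓝 x := mem_interior_iff_mem_nhds.1 hx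
    have h1 : HasFDerivAt a (fderivWithin ℝ a s x) x :=
      (((ha.differentiableOn (by simp)) x (interior_subset hx)).hasFDerivWithinAt).hasFDerivAt hx'
    have h2 := (h1.hasLineDerivAt w).tendsto_slope_zero
    have h3 : fderivWithin ℝ a s x w =
        ∑ i, w i • fderivWithin ℝ a s x (EuclideanSpace.single i 1) := by
      conv_lhs => rw [euclideanSpace_eq_sum w]
      simp
    rw [← h3]
    exact h2

/-- Product rule for families. -/
lemma IsSmoothFamily.smul [IsTopologicalAddGroup Z] [ContinuousSMul ℝ Z]
    {s : Set (EuclideanSpace ℝ (Fin d))} {𝓐 : Set (EuclideanSpace ℝ (Fin d) → ℝ)}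
    {𝓕 : Set (EuclideanSpace ℝ (Fin d) → Z)} (h𝓐 : IsSmoothFamily s 𝓐)
    (h𝓕 : IsSmoothFamily s 𝓕) :
    IsSmoothFamily s (Submodule.span ℝ {H : EuclideanSpace ℝ (Fin d) → Z |
      ∃ a ∈ 𝓐, ∃ F ∈ 𝓕, H = fun x => a x • F x} : Set (EuclideanSpace ℝ (Fin d) → Z)) := by
  refine IsSmoothFamily.span ?_
  rintro _ ⟨a, ha, F, hF, rfl⟩
  obtain ⟨hac, b, hb, had⟩ := h𝓐 a ha
  obtain ⟨hFc, G, hG, hFd⟩ := h𝓕 F hF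
  refine ⟨hac.smul hFc, fun i => (fun x => b i x • F x) + fun x => a x • G i x, fun i => ?_,
    fun x hx w => ?_⟩
  · exact Submodule.add_mem _ (Submodule.subset_span ⟨_, hb i, _, hF, rfl⟩)
      (Submodule.subset_span ⟨_, ha, _, hG i, rfl⟩)
  · have h1 : Tendsto (fun k : ℝ => F (x + k • w)) (𝓝[≠] 0) (𝓝 (F x)) :=
      ((hFc.continuousAt (mem_interior_iff_mem_nhds.1 hx)).tendsto.comp
        (tendsto_add_smul x w)).mono_left nhdsWithin_le_nhds
    have h2 := ((had x hx w).smul h1).add ((hFd x hx w).const_smul (a x))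
    have h3 : ∑ i, w i • ((fun x => b i x • F x) + fun x => a x • G i x) x =
        (∑ i, w i • b i x) • F x + a x • ∑ i, w i • G i x := by
      simp only [Pi.add_apply, smul_add, Finset.sum_add_distrib, Finset.sum_smul,
        Finset.smul_sum, smul_assoc, smul_comm (a x)]
    rw [h3]
    refine h2.congr fun k => ?_
    simp only [smul_eq_mul, mul_smul, smul_sub, sub_smul]
    rw [smul_comm k⁻¹ (a x), smul_comm k⁻¹ (a x)]
    abel

/-- Chain rule for families: the functions `x ↦ D n (f x) (u₁ x, …, uₙ x)`, where `D n` are the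
differentials of the outer function and `uⱼ` belong to the family of the inner function `f`, span
a smooth family. -/
lemma IsSmoothFamily.comp [IsTopologicalAddGroup Y] [ContinuousSMul ℝ Y]
    [LocallyConvexSpace ℝ Y] [T2Space Y]
    [IsTopologicalAddGroup Z] [ContinuousSMul ℝ Z] [LocallyConvexSpace ℝ Z] [T2Space Z]
    {s : Set (EuclideanSpace ℝ (Fin d))} {𝓕 : Set (EuclideanSpace ℝ (Fin d) → Y)}
    (h𝓕 : IsSmoothFamily s 𝓕) {f : EuclideanSpace ℝ (Fin d) → Y} (hf : f ∈ 𝓕)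
    {S : Set Y} (hS : IsOpen S) (hfS : MapsTo f s S) {g : Y → Z} {D} (hg : IsDifferentials g S D) :
    IsSmoothFamily s (Submodule.span ℝ {H : EuclideanSpace ℝ (Fin d) → Z |
      ∃ n, ∃ u : Fin n → EuclideanSpace ℝ (Fin d) → Y, (∀ j, u j ∈ 𝓕) ∧
        H = fun x => D n (f x) (fun j => u j x)} : Set (EuclideanSpace ℝ (Fin d) → Z)) := by
  refine IsSmoothFamily.span ?_
  rintro _ ⟨n, u, hu, rfl⟩
  have hfc := (h𝓕 f hf).1
  obtain ⟨-, f', hf', hfd⟩ := h𝓕 f hf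
  choose hc G hG hd using fun j => h𝓕 _ (hu j)
  have hsnoc : ∀ i x, (fun j => (Fin.snoc (α := fun _ => EuclideanSpace ℝ (Fin d) → Y) u (f' i) :
      Fin (n + 1) → _) j x) =
      Fin.snoc (α := fun _ => Y) (fun j => u j x) (f' i x) := by
    intro i x
    ext j
    cases j using Fin.lastCases <;> simp
  have hupd : ∀ i k x, (fun j => Function.update u k (G k i) j x) =
      Function.update (fun j => u j x) k (G k i x) := by
    intro i k x
    ext j
    rcases eq_or_ne j k with rfl | hjk <;> simp [*]
  refine ⟨?_, fun i => (fun x => D (n + 1) (f x)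
      (Fin.snoc (α := fun _ => Y) (fun j => u j x) (f' i x))) +
    ∑ k, fun x => D n (f x) (Function.update (fun j => u j x) k (G k i x)), fun i => ?_,
    fun x hx w => ?_⟩
  · exact (hg.cont n).comp (f := fun x => (f x, fun j => u j x))
      (hfc.prodMk (continuousOn_pi.2 hc)) fun x hx => ⟨hfS hx, mem_univ _⟩
  · refine Submodule.add_mem _ (Submodule.subset_span ⟨n + 1,
      Fin.snoc (α := fun _ => EuclideanSpace ℝ (Fin d) → Y) u (f' i), fun j => ?_, ?_⟩)
      (Submodule.sum_mem _ fun k _ => Submodule.subset_span ⟨n, Function.update u k (G k i),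
        fun j => ?_, ?_⟩)
    · cases j using Fin.lastCases <;> simp [hf', hu]
    · simp only [hsnoc]
    · rcases eq_or_ne j k with rfl | hjk <;> simp [*]
    · simp only [hupd]
  · have hfx : f x ∈ interior S := by rw [hS.interior_eq]; exact hfS (interior_subset hx)
    have h1 := hg.tendsto_slope_curve n hfx (hfd x hx w) (u := fun k j => u j (x + k • w))
      (u₀ := fun j => u j x) (fun j => hd j x hx w)
    have h2 : ∑ i, w i • ((fun x => D (n + 1) (f x)
        (Fin.snoc (α := fun _ => Y) (fun j => u j x) (f' i x))) +
        ∑ k, fun x => D n (f x) (Function.update (fun j => u j x) k (G k i x))) x =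
        D (n + 1) (f x) (Fin.snoc (α := fun _ => Y) (fun j => u j x) (∑ i, w i • f' i x)) +
        ∑ j, D n (f x) (Function.update (fun j => u j x) j (∑ i, w i • G j i x)) := by
      simp only [hg.map_snoc_sum n hfx, hg.map_update_sum n hfx, Pi.add_apply, smul_add,
        Finset.sum_add_distrib, Finset.sum_apply, Finset.smul_sum]
      congr 1
      exact Finset.sum_comm
    rw [h2]
    refine h1.congr' ?_
    filter_upwards [self_mem_nhdsWithin] with k hk
    have hk : k ≠ 0 := hk
    simp [smul_smul, hk]

end Families

/-! ### Operations on smooth maps -/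

section Smooth

variable {d : ℕ} {X Y Z : Type*}
  [AddCommGroup X] [Module ℝ X] [TopologicalSpace X]
  [AddCommGroup Y] [Module ℝ Y] [TopologicalSpace Y]
  [AddCommGroup Z] [Module ℝ Z] [TopologicalSpace Z]

lemma IsSmoothOn.mono {f : X → Y} {s t : Set X} (h : IsSmoothOn f s) (hts : t ⊆ s) :
    IsSmoothOn f t := by
  obtain ⟨D, h0, hc, hd⟩ := h
  exact ⟨D, fun x hx => h0 x (hts hx), fun n => (hc n).mono (prod_mono hts subset_rfl),
    fun n x hx => hd n x (interior_mono hts hx)⟩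

lemma IsSmoothOn.congr {f g : X → Y} {s : Set X} (h : IsSmoothOn f s) (hfg : EqOn g f s) :
    IsSmoothOn g s := by
  obtain ⟨D, h0, hc, hd⟩ := h
  exact ⟨D, fun x hx v => (h0 x hx v).trans (hfg hx).symm, hc, hd⟩

lemma isSmoothOn_empty (f : X → Y) : IsSmoothOn f (∅ : Set X) :=
  ⟨fun _ _ _ => 0, by simp, by simp, by simp⟩

lemma isSmoothOn_const (c : Y) (s : Set X) : IsSmoothOn (fun _ => c) s := by
  refine ⟨fun n _ _ => if n = 0 then c else 0, by simp, fun n => continuousOn_const,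
    fun n x _ v w => ?_⟩
  simpa using tendsto_const_nhds

lemma IsSmoothOn.add [IsTopologicalAddGroup Y] [ContinuousSMul ℝ Y] {f g : X → Y} {s : Set X}
    (hf : IsSmoothOn f s) (hg : IsSmoothOn g s) : IsSmoothOn (fun x => f x + g x) s := by
  obtain ⟨D, h0, hc, hd⟩ := hf
  obtain ⟨D', h0', hc', hd'⟩ := hg
  refine ⟨fun n x v => D n x v + D' n x v, fun x hx v => congrArg₂ (· + ·) (h0 x hx v) (h0' x hx v),
    fun n => (hc n).add (hc' n), fun n x hx v w => ?_⟩
  refine ((hd n x hx v w).add (hd' n x hx v w)).congr fun k => ?_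
  rw [← smul_add, add_sub_add_comm]

lemma IsSmoothOn.sum [IsTopologicalAddGroup Y] [ContinuousSMul ℝ Y] {ι : Type*} {t : Finset ι}
    {f : ι → X → Y} {s : Set X} (hf : ∀ i ∈ t, IsSmoothOn (f i) s) :
    IsSmoothOn (fun x => ∑ i ∈ t, f i x) s := by
  classical
  induction t using Finset.induction with
  | empty => simpa using isSmoothOn_const (0 : Y) s
  | insert i t hi ih =>
    simp only [Finset.sum_insert hi]
    exact (hf i (Finset.mem_insert_self i t)).add
      (ih fun j hj => hf j (Finset.mem_insert_of_mem hj))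

lemma IsSmoothOn.exists_family [IsTopologicalAddGroup Y] [ContinuousSMul ℝ Y]
    [LocallyConvexSpace ℝ Y] [T2Space Y] {f : EuclideanSpace ℝ (Fin d) → Y}
    {s : Set (EuclideanSpace ℝ (Fin d))} (hf : IsSmoothOn f s) :
    ∃ 𝓕, IsSmoothFamily s 𝓕 ∧ ∃ F ∈ 𝓕, EqOn f F s := by
  obtain ⟨D, hD⟩ := isSmoothOn_iff.1 hf
  exact ⟨_, hD.isSmoothFamily, _, ⟨0, Fin.elim0, rfl⟩, fun x hx => (hD.zero x hx _).symm⟩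

lemma IsSmoothOn.smul [IsTopologicalAddGroup Y] [ContinuousSMul ℝ Y]
    [LocallyConvexSpace ℝ Y] [T2Space Y] {a : EuclideanSpace ℝ (Fin d) → ℝ}
    {f : EuclideanSpace ℝ (Fin d) → Y} {s : Set (EuclideanSpace ℝ (Fin d))}
    (hs : UniqueDiffOn ℝ s) (ha : ContDiffOn ℝ ∞ a s) (hf : IsSmoothOn f s) :
    IsSmoothOn (fun x => a x • f x) s := by
  obtain ⟨𝓕, h𝓕, F, hF, hfF⟩ := hf.exists_family
  refine (((isSmoothFamily_contDiffOn hs).smul h𝓕).isSmoothOn (Submodule.subset_span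
    ⟨a, ha, F, hF, rfl⟩)).congr fun x hx => ?_
  simp only [hfF hx]

lemma IsSmoothOn.comp [IsTopologicalAddGroup Y] [ContinuousSMul ℝ Y]
    [LocallyConvexSpace ℝ Y] [T2Space Y]
    [IsTopologicalAddGroup Z] [ContinuousSMul ℝ Z] [LocallyConvexSpace ℝ Z] [T2Space Z]
    {f : EuclideanSpace ℝ (Fin d) → Y} {s : Set (EuclideanSpace ℝ (Fin d))} {g : Y → Z} {S : Set Y}
    (hg : IsSmoothOn g S) (hf : IsSmoothOn f s) (hS : IsOpen S) (hfS : MapsTo f s S) :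
    IsSmoothOn (fun x => g (f x)) s := by
  obtain ⟨𝓕, h𝓕, F, hF, hfF⟩ := hf.exists_family
  obtain ⟨D, hD⟩ := isSmoothOn_iff.1 hg
  refine ((h𝓕.comp hF hS (hfS.congr hfF) hD).isSmoothOn (Submodule.subset_span
    ⟨0, Fin.elim0, fun j => j.elim0, rfl⟩)).congr fun x hx => ?_
  have := hD.zero (f x) (hfS hx) (fun j => (Fin.elim0 j : EuclideanSpace ℝ (Fin d) → Y) x)
  rw [← this, hfF hx]

/-- The differentials are determined by `f`: on the interior of `s` as iterated limits, on `s` by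
continuity. -/
lemma IsDifferentials.eqOn [ContinuousAdd X] [ContinuousSMul ℝ X] [T2Space Y] {f : X → Y}
    {s : Set X} (hs : s ⊆ closure (interior s)) {D D'} (h : IsDifferentials f s D)
    (h' : IsDifferentials f s D') (n : ℕ) :
    EqOn (fun p : X × (Fin n → X) => D n p.1 p.2) (fun p => D' n p.1 p.2) (s ×ˢ univ) := by
  have hint : ∀ n, ∀ x ∈ interior s, ∀ v : Fin n → X, D n x v = D' n x v := by
    intro n
    induction n with
    | zero =>
      intro x hx v
      rw [h.zero x (interior_subset hx), h'.zero x (interior_subset hx)]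
    | succ n ih =>
      intro x hx v
      rw [← Fin.snoc_init_self v]
      exact (h.deriv n x hx _ _).unique ((h'.deriv n x hx _ _).congr_on isOpen_interior
        (fun y hy => (ih y hy _).symm) hx)
  refine EqOn.of_subset_closure (s := interior s ×ˢ univ) (fun p hp => hint n p.1 hp.1 p.2)
    (h.cont n) (h'.cont n) (prod_mono interior_subset subset_rfl) ?_
  rw [closure_prod_eq, closure_univ]
  exact prod_mono hs subset_rfl

/-- Smoothness is a local property. -/
lemma isSmoothOn_of_locally [ContinuousAdd X] [ContinuousSMul ℝ X] [T2Space Y] {f : X → Y}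
    {s : Set X} (hs : s ⊆ closure (interior s))
    (h : ∀ x ∈ s, ∃ W, IsOpen W ∧ x ∈ W ∧ IsSmoothOn f (s ∩ W)) : IsSmoothOn f s := by
  classical
  simp only [isSmoothOn_iff] at h
  choose! W hWo hxW D hD using h
  -- Differentials of different pieces agree on the overlap.
  have heq : ∀ a ∈ s, ∀ x ∈ s ∩ W a, ∀ n (v : Fin n → X), D x n x v = D a n x v := by
    intro a ha x hx n v
    have hsub : s ∩ (W x ∩ W a) ⊆ closure (interior (s ∩ (W x ∩ W a))) := by
      rw [interior_inter, ((hWo x hx.1).inter (hWo a ha)).interior_eq]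
      rintro y ⟨hys, hyW⟩
      rw [inter_comm]
      exact ((hWo x hx.1).inter (hWo a ha)).inter_closure ⟨hyW, hs hys⟩
    have restr : ∀ {t t' : Set X} {D}, t ⊆ t' → IsDifferentials f t' D → IsDifferentials f t D :=
      fun hts hD => ⟨fun x hx => hD.zero x (hts hx),
        fun n => (hD.cont n).mono (prod_mono hts subset_rfl),
        fun n x hx => hD.deriv n x (interior_mono hts hx)⟩
    exact (restr (inter_subset_inter_right s inter_subset_left) (hD x hx.1)).eqOn hsub
      (restr (inter_subset_inter_right s inter_subset_right) (hD a ha)) n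
      (show (x, v) ∈ _ from ⟨⟨hx.1, hxW x hx.1, hx.2⟩, mem_univ _⟩)
  refine isSmoothOn_iff.2 ⟨fun n x v => D x n x v, fun x hx v => ?_, fun n => ?_,
    fun n x hx v w => ?_⟩
  · exact (hD x hx).zero x ⟨hx, hxW x hx⟩ v
  · rintro ⟨a, v⟩ ⟨ha, -⟩
    have h1 := (hD a ha).cont n (a, v) ⟨⟨ha, hxW a ha⟩, mem_univ _⟩
    have h2 : ContinuousWithinAt (fun p : X × (Fin n → X) => D p.1 n p.1 p.2)
        ((s ∩ W a) ×ˢ univ) (a, v) :=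
      h1.congr (fun p hp => heq a ha p.1 hp.1 n p.2) rfl
    refine h2.mono_of_mem_nhdsWithin ?_
    have : (W a ×ˢ univ : Set (X × (Fin n → X))) ∈ 𝓝 (a, v) :=
      ((hWo a ha).prod isOpen_univ).mem_nhds ⟨hxW a ha, mem_univ _⟩
    filter_upwards [self_mem_nhdsWithin, mem_nhdsWithin_of_mem_nhds this] with p hp hp'
    exact ⟨⟨hp.1, hp'.1⟩, mem_univ _⟩
  · have hxs := interior_subset hx
    have hxi : x ∈ interior (s ∩ W x) := by
      rw [interior_inter, (hWo x hxs).interior_eq]; exact ⟨hx, hxW x hxs⟩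
    exact ((hD x hxs).deriv n x hxi v w).congr_on isOpen_interior
      (fun y hy => (heq x hxs y (interior_subset hy) n v).symm) hxi

end Smooth

/-! ### Smoothness of maps on a manifold with corners -/

section Manifold

variable {d : ℕ} {M : Type uM} [TopologicalSpace M] [ChartedSpace (EuclideanQuadrant d) M]
  {N : Type uN} [TopologicalSpace N]

/-- The part of the extended target of the chart `φ` that corresponds to `W ⊆ M`. -/
def chartDomain (φ : OpenPartialHomeomorph M (EuclideanQuadrant d)) (W : Set M) :
    Set (EuclideanSpace ℝ (Fin d)) :=
  (φ.extend (modelWithCornersEuclideanQuadrant d)).target ∩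
    (φ.extend (modelWithCornersEuclideanQuadrant d)).symm ⁻¹' W

lemma chartDomain_mono (φ : OpenPartialHomeomorph M (EuclideanQuadrant d)) {W W' : Set M}
    (h : W ⊆ W') : chartDomain φ W ⊆ chartDomain φ W' :=
  inter_subset_inter_right _ (preimage_mono h)

lemma exists_isOpen_chartDomain_eq (φ : OpenPartialHomeomorph M (EuclideanQuadrant d)) {W : Set M}
    (hW : IsOpen W) :
    ∃ O, IsOpen O ∧ chartDomain φ W = range (modelWithCornersEuclideanQuadrant d) ∩ O := by
  refine ⟨(modelWithCornersEuclideanQuadrant d).symm ⁻¹' (φ.target ∩ φ.symm ⁻¹' W),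
    (φ.isOpen_inter_preimage_symm hW).preimage
      (modelWithCornersEuclideanQuadrant d).continuous_symm, ?_⟩
  rw [chartDomain, φ.extend_target, φ.extend_coe_symm]
  ext y
  simp only [mem_inter_iff, mem_preimage, Function.comp]
  tauto

lemma uniqueDiffOn_chartDomain (φ : OpenPartialHomeomorph M (EuclideanQuadrant d)) {W : Set M}
    (hW : IsOpen W) : UniqueDiffOn ℝ (chartDomain φ W) := by
  obtain ⟨O, hO, h⟩ := exists_isOpen_chartDomain_eq φ hW
  rw [h]
  exact (ModelWithCorners.uniqueDiffOn _).inter hO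

lemma chartDomain_subset_closure_interior (φ : OpenPartialHomeomorph M (EuclideanQuadrant d))
    {W : Set M} (hW : IsOpen W) :
    chartDomain φ W ⊆ closure (interior (chartDomain φ W)) := by
  obtain ⟨O, hO, h⟩ := exists_isOpen_chartDomain_eq φ hW
  rw [h, interior_inter, hO.interior_eq, inter_comm, inter_comm _ O]
  exact fun y hy => hO.inter_closure
    ⟨hy.1, (modelWithCornersEuclideanQuadrant d).range_subset_closure_interior hy.2⟩

lemma contDiffOn_chartDomain [IsManifold (modelWithCornersEuclideanQuadrant d) ∞ M]
    {φ : OpenPartialHomeomorph M (EuclideanQuadrant d)} (hφ : φ ∈ atlas (EuclideanQuadrant d) M)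
    {μ : M → ℝ} (hμ : ContMDiff (modelWithCornersEuclideanQuadrant d) 𝓘(ℝ) ∞ μ) (W : Set M) :
    ContDiffOn ℝ ∞ (fun y => μ ((φ.extend (modelWithCornersEuclideanQuadrant d)).symm y))
      (chartDomain φ W) := by
  have h := contMDiffOn_extend_symm (I := modelWithCornersEuclideanQuadrant d) (n := ∞)
    (IsManifold.subset_maximalAtlas hφ)
  refine (contMDiffOn_iff_contDiffOn.1 (hμ.comp_contMDiffOn h)).mono fun y hy => ?_
  have := hy.1
  rw [φ.extend_target] at this
  obtain ⟨h1, z, rfl⟩ := this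
  exact ⟨z, by simpa using h1, rfl⟩

variable {𝒜 : LocallyConvexAtlas.{uN, uI, uE} N} {f g : C(M, N)} {W W' : Set M}

lemma SmoothOnOpen.mono (h : SmoothOnOpen d 𝒜 f W) (hW : W' ⊆ W) : SmoothOnOpen d 𝒜 f W' :=
  fun φ hφ i => (h φ hφ i).mono (chartDomain_mono φ (inter_subset_inter_left _ hW))

lemma SmoothOnOpen.congr (h : SmoothOnOpen d 𝒜 f W) (hfg : EqOn g f W) :
    SmoothOnOpen d 𝒜 g W := by
  intro φ hφ i
  have hW : W ∩ g ⁻¹' (𝒜.chart i).source ⊆ W ∩ f ⁻¹' (𝒜.chart i).source :=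
    fun x hx => ⟨hx.1, by simpa only [mem_preimage, hfg hx.1] using hx.2⟩
  exact ((h φ hφ i).mono (chartDomain_mono φ hW)).congr fun y hy =>
    congrArg (𝒜.chart i) (hfg hy.2.1)

lemma smoothOnOpen_empty (f : C(M, N)) : SmoothOnOpen d 𝒜 f ∅ := fun _ _ _ =>
  (isSmoothOn_empty _).mono fun _ hy => hy.2.1

lemma smoothOnOpen_of_locally (hW : IsOpen W)
    (h : ∀ x ∈ W, ∃ W', IsOpen W' ∧ x ∈ W' ∧ SmoothOnOpen d 𝒜 f W') : SmoothOnOpen d 𝒜 f W := by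
  intro φ hφ i
  have hopen := hW.inter (f.continuous.isOpen_preimage _ (𝒜.chart i).open_source)
  refine isSmoothOn_of_locally (chartDomain_subset_closure_interior φ hopen) fun y hy => ?_
  obtain ⟨W', hW', hyW', hs⟩ := h _ hy.2.1
  obtain ⟨O, hO, heq⟩ := exists_isOpen_chartDomain_eq φ hW'
  have hyO : y ∈ chartDomain φ W' := ⟨hy.1, hyW'⟩
  rw [heq] at hyO
  refine ⟨O, hO, hyO.2, (hs φ hφ i).mono ?_⟩
  rintro z ⟨hz, hzO⟩
  have hzr : z ∈ range (modelWithCornersEuclideanQuadrant d) := by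
    have := hz.1
    rw [φ.extend_target] at this
    exact this.2
  have hzW : z ∈ chartDomain φ W' := by rw [heq]; exact ⟨hzr, hzO⟩
  exact ⟨hz.1, hzW.2, hz.2.2⟩

/-- A map with values in the domain of one chart of `N` is smooth if its coordinate
representations with respect to this chart are. -/
lemma smoothOnOpen_of_chart (i : 𝒜.Index)
    (hWi : W ⊆ f ⁻¹' (𝒜.chart i).source)
    (h : ∀ φ ∈ atlas (EuclideanQuadrant d) M, IsSmoothOn (fun y => 𝒜.chart i
      (f ((φ.extend (modelWithCornersEuclideanQuadrant d)).symm y))) (chartDomain φ W)) :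
    SmoothOnOpen d 𝒜 f W := by
  intro φ hφ j
  have h1 := (h φ hφ).mono (chartDomain_mono φ
    (inter_subset_left (t := f ⁻¹' (𝒜.chart j).source)))
  have h2 : ∀ y ∈ chartDomain φ (W ∩ f ⁻¹' (𝒜.chart j).source),
      (𝒜.chart i).symm (𝒜.chart i
        (f ((φ.extend (modelWithCornersEuclideanQuadrant d)).symm y))) =
      f ((φ.extend (modelWithCornersEuclideanQuadrant d)).symm y) := fun y hy =>
    (𝒜.chart i).left_inv (hWi hy.2.1)
  refine ((𝒜.compatible i j).comp h1 (OpenPartialHomeomorph.open_source _)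
    fun y hy => ?_).congr fun y hy => ?_
  · rw [OpenPartialHomeomorph.trans_source]
    refine ⟨(𝒜.chart i).map_source (hWi hy.2.1), ?_⟩
    rw [mem_preimage, h2 y hy]
    exact hy.2.2
  · simp only [h2 y hy]

end Manifold

/-! ### Smoothing inside one chart of the target -/

section Step

lemma Convex.sum_smul_mem_of_sum_le_one {E ι : Type*} [AddCommGroup E] [Module ℝ E] {s : Set E}
    (hs : Convex ℝ s) (h0 : (0 : E) ∈ s) {t : Finset ι} {w : ι → ℝ} {z : ι → E}
    (hw : ∀ i ∈ t, 0 ≤ w i) (hw1 : ∑ i ∈ t, w i ≤ 1) (hz : ∀ i ∈ t, w i ≠ 0 → z i ∈ s) :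
    ∑ i ∈ t, w i • z i ∈ s := by
  classical
  rcases (Finset.sum_nonneg hw).eq_or_lt with hm | hm
  · rw [Finset.sum_eq_zero fun i hi => ?_]
    · exact h0
    · rw [(Finset.sum_eq_zero_iff_of_nonneg hw).1 hm.symm i hi, zero_smul]
  · have h1 : ∑ i ∈ t, w i • z i =
        (∑ i ∈ t, w i) • ∑ i ∈ t, ((∑ i ∈ t, w i)⁻¹ * w i) • (if w i ≠ 0 then z i else 0) := by
      rw [Finset.smul_sum]
      refine Finset.sum_congr rfl fun i _ => ?_
      rw [smul_smul, mul_inv_cancel_left₀ hm.ne']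
      split_ifs with h
      · rfl
      · simp [not_not.1 h]
    rw [h1]
    refine hs.smul_mem_of_zero_mem h0 (hs.sum_mem (fun i hi => ?_) ?_ fun i hi => ?_) ⟨hm.le, hw1⟩
    · exact mul_nonneg (inv_nonneg.2 hm.le) (hw i hi)
    · rw [← Finset.mul_sum, inv_mul_cancel₀ hm.ne']
    · split_ifs with h
      · exact hz i hi h
      · exact h0

variable {d : ℕ} {M : Type uM} [TopologicalSpace M] [ChartedSpace (EuclideanQuadrant d) M]
  {N : Type uN} [TopologicalSpace N] {𝒜 : LocallyConvexAtlas.{uN, uI, uE} N}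

/-- On a compact set mapped into one chart, a uniform perturbation of `f` in the chart stays inside
any prescribed neighbourhood of the graph. -/
lemma exists_convex_perturbation (f : C(M, N)) {V : Set (M × N)} (hV : IsOpen V)
    (hf : ∀ x, (x, f x) ∈ V) (i : 𝒜.Index) {K : Set M} (hK : IsCompact K)
    (hKi : K ⊆ f ⁻¹' (𝒜.chart i).source) :
    ∃ E : Set (𝒜.Model i), 0 ∈ E ∧ IsOpen E ∧ Convex ℝ E ∧ ∀ e ∈ E, ∀ x ∈ K,
      𝒜.chart i (f x) + e ∈ (𝒜.chart i).target ∧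
        (x, (𝒜.chart i).symm (𝒜.chart i (f x) + e)) ∈ V := by
  have key := hK.eventually_forall_of_forall_eventually (x₀ := (0 : 𝒜.Model i))
    (P := fun e x => 𝒜.chart i (f x) + e ∈ (𝒜.chart i).target ∧
      (x, (𝒜.chart i).symm (𝒜.chart i (f x) + e)) ∈ V) fun x hx => ?_
  · obtain ⟨E, ⟨h0, hEo, hE⟩, hsub⟩ :=
      (LocallyConvexSpace.convex_open_basis_zero ℝ (𝒜.Model i)).mem_iff.1 key
    exact ⟨E, h0, hEo, hE, fun e he => hsub he⟩
  · have h1 : Tendsto (fun z : 𝒜.Model i × M => 𝒜.chart i (f z.2) + z.1) (𝓝 (0, x))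
        (𝓝 (𝒜.chart i (f x))) := by
      have h2 : ContinuousAt (fun z : 𝒜.Model i × M => 𝒜.chart i (f z.2)) (0, x) :=
        ContinuousAt.comp_of_eq ((𝒜.chart i).continuousAt (hKi hx))
          (f.continuous.comp continuous_snd).continuousAt rfl
      simpa using h2.tendsto.add (continuous_fst.tendsto ((0 : 𝒜.Model i), x))
    have ht := (𝒜.chart i).map_source (hKi hx)
    have h3 := ((𝒜.chart i).continuousAt_symm ht).tendsto.comp h1
    have h4 : Tendsto (fun z : 𝒜.Model i × M =>
        (z.2, (𝒜.chart i).symm (𝒜.chart i (f z.2) + z.1))) (𝓝 (0, x)) (𝓝 (x, f x)) := by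
      rw [(𝒜.chart i).left_inv (hKi hx)] at h3
      exact (continuous_snd.tendsto ((0 : 𝒜.Model i), x)).prodMk_nhds h3
    exact (h1.eventually ((𝒜.chart i).open_target.mem_nhds ht)).and
      (h4.eventually (hV.mem_nhds (hf x)))

variable [T2Space M] [SigmaCompactSpace M]
  [IsManifold (modelWithCornersEuclideanQuadrant d) ∞ M]

/-- The basic smoothing step. In the chart `i`, the map `f` is moved linearly to
`(1 - ∑ μₐ) f + ∑ μₐ cₐ`, where `cₐ` are values of `f` and the `μₐ` form a smooth partition of unity
on `C` supported in `Q`. The result is smooth wherever `f` is, and on the interior of `C`. -/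
lemma exists_smoothing_step (f : C(M, N)) {V : Set (M × N)} (hV : IsOpen V)
    (hf : ∀ x, (x, f x) ∈ V) {W : Set M} (hW : IsOpen W) (hfW : SmoothOnOpen d 𝒜 f W)
    (i : 𝒜.Index) {C Q : Set M} (hC : IsCompact C) (hQ : IsOpen Q) (hCQ : C ⊆ Q)
    (hQc : IsCompact (closure Q)) (hQi : closure Q ⊆ f ⁻¹' (𝒜.chart i).source) :
    ∃ F : C(unitInterval × M, N), (∀ x, F (0, x) = f x) ∧ (∀ t, ∀ x ∉ Q, F (t, x) = f x) ∧
      (∀ t x, (x, F (t, x)) ∈ V) ∧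
      ∀ g : C(M, N), (∀ x, g x = F (1, x)) → SmoothOnOpen d 𝒜 g (W ∪ interior C) := by
  classical
  obtain ⟨E, hE0, hEo, hEc, hEV⟩ := exists_convex_perturbation f hV hf i hQc hQi
  have hQs : Q ⊆ f ⁻¹' (𝒜.chart i).source := subset_closure.trans hQi
  let χ : M → 𝒜.Model i := fun x => 𝒜.chart i (f x)
  have hχc : ContinuousOn χ Q :=
    (𝒜.chart i).continuousOn.comp f.continuous.continuousOn hQs
  let O : M → Set M := fun a => Q ∩ χ ⁻¹' ((fun y => χ a - y) ⁻¹' E)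
  have hO : ∀ a, IsOpen (O a) := fun a =>
    hχc.isOpen_inter_preimage hQ (hEo.preimage (by fun_prop))
  obtain ⟨T, -, hT⟩ := hC.elim_nhds_subcover O fun a ha =>
    (hO a).mem_nhds ⟨hCQ ha, by simpa using hE0⟩
  obtain ⟨μ, hμ⟩ := SmoothPartitionOfUnity.exists_isSubordinate
    (modelWithCornersEuclideanQuadrant d) hC.isClosed (fun a : T => O a) (fun a => hO a)
    (fun x hx => by simpa using hT hx)
  have hμ0 : ∀ a x, 0 ≤ μ a x := fun a x => μ.nonneg a x
  have hμ1 : ∀ x, ∑ a, μ a x ≤ 1 := fun x => by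
    rw [← finsum_eq_sum_of_fintype]; exact μ.sum_le_one x
  have hμC : ∀ x ∈ C, ∑ a, μ a x = 1 := fun x hx => by
    rw [← finsum_eq_sum_of_fintype]; exact μ.sum_eq_one hx
  let S : Set M := ⋃ a, tsupport (μ a)
  have hS : IsClosed S := isClosed_iUnion_of_finite fun a => isClosed_tsupport _
  have hSQ : S ⊆ Q := iUnion_subset fun a => (hμ a).trans inter_subset_left
  have hμS : ∀ x ∉ S, ∀ a, μ a x = 0 := fun x hx a => by
    by_contra h
    exact hx (mem_iUnion.2 ⟨a, subset_tsupport _ h⟩)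
  let p : unitInterval × M → 𝒜.Model i := fun z => ∑ a, (z.1 * μ a z.2 : ℝ) • (χ a - χ z.2)
  have hpE : ∀ z, p z ∈ E := fun z => by
    refine hEc.sum_smul_mem_of_sum_le_one hE0 (fun a _ => mul_nonneg z.1.2.1 (hμ0 a _)) ?_
      fun a _ ha => ?_
    · rw [← Finset.mul_sum]
      exact mul_le_one₀ z.1.2.2 (Finset.sum_nonneg fun a _ => hμ0 a _) (hμ1 _)
    · exact (hμ a (subset_tsupport _ (right_ne_zero_of_mul ha))).2
  have hp0 : ∀ t, ∀ x ∉ S, p (t, x) = 0 := fun t x hx => by simp [p, hμS x hx]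
  let Φ : unitInterval × M → N := fun z =>
    if z.2 ∈ Q then (𝒜.chart i).symm (χ z.2 + p z) else f z.2
  have hΦS : ∀ t, ∀ x ∉ S, Φ (t, x) = f x := fun t x hx => by
    by_cases hxQ : x ∈ Q
    · simp only [Φ, hxQ, if_true, hp0 t x hx, add_zero]
      exact (𝒜.chart i).left_inv (hQs hxQ)
    · simp [Φ, hxQ]
  have hΦQ : ∀ t, ∀ x ∈ Q, Φ (t, x) = (𝒜.chart i).symm (χ x + p (t, x)) := fun t x hx => by
    simp [Φ, hx]
  have hΦc : Continuous Φ := by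
    refine continuous_iff_continuousAt.2 fun ⟨t, x⟩ => ?_
    by_cases hx : x ∈ S
    · have hopen : IsOpen (univ ×ˢ Q : Set (unitInterval × M)) := isOpen_univ.prod hQ
      have hχ2 : ContinuousOn (fun z : unitInterval × M => χ z.2) (univ ×ˢ Q) :=
        hχc.comp continuousOn_snd fun z hz => hz.2
      have hpc : ContinuousOn p (univ ×ˢ Q) := by
        refine continuousOn_finsetSum _ fun a _ => ContinuousOn.smul ?_
          (continuousOn_const.sub hχ2)
        have := (μ a).contMDiff.continuous
        fun_prop
      have h1 : ContinuousOn (fun z : unitInterval × M => (𝒜.chart i).symm (χ z.2 + p z))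
          (univ ×ˢ Q) :=
        (𝒜.chart i).continuousOn_symm.comp (hχ2.add hpc) fun z hz =>
          (hEV _ (hpE z) z.2 (subset_closure hz.2)).1
      refine (h1.congr fun z hz => ?_).continuousAt (hopen.mem_nhds ⟨mem_univ _, hSQ hx⟩)
      exact hΦQ z.1 z.2 hz.2
    · have hopen : IsOpen (univ ×ˢ Sᶜ : Set (unitInterval × M)) :=
        isOpen_univ.prod hS.isOpen_compl
      refine ContinuousAt.congr (f.continuous.comp continuous_snd).continuousAt ?_
      filter_upwards [hopen.mem_nhds ⟨mem_univ _, hx⟩] with z hz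
      exact (hΦS z.1 z.2 hz.2).symm
  refine ⟨⟨Φ, hΦc⟩, fun x => ?_, fun t x hx => hΦS t x fun h => hx (hSQ h), fun t x => ?_,
    fun g hg => ?_⟩
  · by_cases hx : x ∈ Q
    · have : p (0, x) = 0 := by simp [p]
      change Φ (0, x) = f x
      rw [hΦQ 0 x hx, this, add_zero]
      exact (𝒜.chart i).left_inv (hQs hx)
    · exact hΦS 0 x fun h => hx (hSQ h)
  · change (x, Φ (t, x)) ∈ V
    by_cases hx : x ∈ Q
    · rw [hΦQ t x hx]
      exact (hEV _ (hpE _) x (subset_closure hx)).2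
    · rw [hΦS t x fun h => hx (hSQ h)]
      exact hf x
  · replace hg : ∀ x, g x = Φ (1, x) := hg
    have hgQ : Q ⊆ g ⁻¹' (𝒜.chart i).source := fun x hx => by
      rw [mem_preimage, hg, hΦQ 1 x hx]
      exact (𝒜.chart i).map_target (hEV _ (hpE _) x (subset_closure hx)).1
    have hgχ : ∀ x ∈ Q, 𝒜.chart i (g x) = (1 - ∑ a, μ a x) • χ x + ∑ a, μ a x • χ a := by
      intro x hx
      rw [hg, hΦQ 1 x hx, (𝒜.chart i).right_inv (hEV _ (hpE _) x (subset_closure hx)).1]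
      simp only [p, smul_sub, Finset.sum_sub_distrib, sub_smul, one_smul, Finset.sum_smul,
        Set.Icc.coe_one, one_mul]
      abel
    have hsum : ∀ φ ∈ atlas (EuclideanQuadrant d) M, ∀ W' : Set M, IsOpen W' →
        IsSmoothOn (fun y => ∑ a : T,
          μ a ((φ.extend (modelWithCornersEuclideanQuadrant d)).symm y) • χ a)
          (chartDomain φ W') := fun φ hφ W' hW' =>
      IsSmoothOn.sum fun a _ => IsSmoothOn.smul (uniqueDiffOn_chartDomain φ hW')
        (contDiffOn_chartDomain hφ (μ a).contMDiff W') (isSmoothOn_const (χ a) _)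
    have hCS : C ⊆ S := fun x hx => by
      by_contra h
      simpa [hμS x h] using hμC x hx
    refine smoothOnOpen_of_locally (hW.union isOpen_interior) fun x hx => ?_
    by_cases hxS : x ∈ S
    · rcases hx with hxW | hxC
      · refine ⟨W ∩ Q, hW.inter hQ, ⟨hxW, hSQ hxS⟩,
          smoothOnOpen_of_chart i (inter_subset_right.trans hgQ) fun φ hφ => ?_⟩
        have h1 := (hfW φ hφ i).mono (chartDomain_mono φ (inter_subset_inter_right W hQs))
        have hm : ContMDiff (modelWithCornersEuclideanQuadrant d) 𝓘(ℝ) ∞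
            (fun x => 1 - ∑ a, μ a x) :=
          contMDiff_const.sub (ContMDiff.sum fun a _ => (μ a).contMDiff)
        exact (((h1.smul (uniqueDiffOn_chartDomain φ (hW.inter hQ))
          (contDiffOn_chartDomain hφ hm _))).add (hsum φ hφ _ (hW.inter hQ))).congr
          fun y hy => hgχ _ hy.2.2
      · refine ⟨interior C, isOpen_interior, hxC,
          smoothOnOpen_of_chart i ((interior_subset.trans hCQ).trans hgQ) fun φ hφ => ?_⟩
        refine (hsum φ hφ _ isOpen_interior).congr fun y hy => ?_
        have hyC := interior_subset hy.2
        simp only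
        rw [hgχ _ (hCQ hyC), hμC _ hyC, sub_self, zero_smul, zero_add]
    · have hxW : x ∈ W := hx.resolve_right fun h => hxS (hCS (interior_subset h))
      exact ⟨W ∩ Sᶜ, hW.inter hS.isOpen_compl, ⟨hxW, hxS⟩,
        (hfW.mono inter_subset_left).congr fun y hy => by rw [hg, hΦS 1 y hy.2]⟩

end Step

/-! ### Countable covers -/

/-- The union of the members of a locally finite cover by relatively compact open sets that can be
reached from a given point by finite chains is both open and closed, and is a countable union of
compact sets. -/
lemma sigmaCompactSpace_of_connected_paracompact (M : Type*) [TopologicalSpace M] [T2Space M]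
    [ParacompactSpace M] [ConnectedSpace M] [LocallyCompactSpace M] : SigmaCompactSpace M := by
  have hex : ∀ x : M, ∃ u, IsOpen u ∧ x ∈ u ∧ IsCompact (closure u) := fun x => by
    obtain ⟨u, hu, hxu, -, hc⟩ := exists_open_between_and_isCompact_closure
      (isCompact_singleton (x := x)) isOpen_univ (subset_univ _)
    exact ⟨u, hu, hxu rfl, hc⟩
  choose u hu hxu huc using hex
  obtain ⟨v, hvo, hvU, hvf, hvu⟩ := precise_refinement u hu
    (eq_univ_of_forall fun x => mem_iUnion.2 ⟨x, hxu x⟩)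
  have hvc : ∀ a, IsCompact (closure (v a)) := fun a =>
    (huc a).of_isClosed_subset isClosed_closure (closure_mono (hvu a))
  have hcov : ∀ x, ∃ a, x ∈ v a := fun x => mem_iUnion.1 (hvU ▸ mem_univ x)
  obtain ⟨x₀⟩ : Nonempty M := inferInstance
  let K : ℕ → Set M := fun n =>
    Nat.rec {x₀} (fun _ A => ⋃ b ∈ {b | (v b ∩ A).Nonempty}, closure (v b)) n
  have hK1 : ∀ n, K (n + 1) = ⋃ b ∈ {b | (v b ∩ K n).Nonempty}, closure (v b) := fun _ => rfl
  have hKc : ∀ n, IsCompact (K n) := by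
    intro n
    induction n with
    | zero => exact isCompact_singleton
    | succ n ih =>
      rw [hK1]
      exact (hvf.finite_nonempty_inter_compact ih).isCompact_biUnion fun b _ => hvc b
  have hstep : ∀ n b, (v b ∩ K n).Nonempty → v b ⊆ K (n + 1) := fun n b hb x hx =>
    mem_biUnion (show b ∈ {b | (v b ∩ K n).Nonempty} from hb) (subset_closure hx)
  have hclopen : IsClopen (⋃ n, K n) := by
    constructor
    · refine isClosed_of_closure_subset fun x hx => ?_
      obtain ⟨b, hb⟩ := hcov x
      obtain ⟨y, hyb, hy⟩ := mem_closure_iff.1 hx _ (hvo b) hb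
      obtain ⟨n, hn⟩ := mem_iUnion.1 hy
      exact mem_iUnion.2 ⟨n + 1, hstep n b ⟨y, hyb, hn⟩ hb⟩
    · refine isOpen_iff_mem_nhds.2 fun x hx => ?_
      obtain ⟨n, hn⟩ := mem_iUnion.1 hx
      obtain ⟨b, hb⟩ := hcov x
      exact mem_of_superset ((hvo b).mem_nhds hb)
        ((hstep n b ⟨x, hb, hn⟩).trans (subset_iUnion K (n + 1)))
  have huniv : ⋃ n, K n = univ := hclopen.eq_univ ⟨x₀, mem_iUnion.2 ⟨0, rfl⟩⟩
  exact ⟨⟨K, hKc, huniv⟩⟩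

section Cover

variable {M : Type uM} [TopologicalSpace M] [T2Space M] [LocallyCompactSpace M]
  [SigmaCompactSpace M] {N : Type uN} [TopologicalSpace N]

/-- A closed set `B ⊆ U` has a countable cover by the interiors of compact sets `C a`, contained in
the members `Q a ⊆ U` of a locally finite family of open relatively compact sets, such that `f` maps
the closure of each `Q a` into the domain of a chart of `N`. -/
lemma exists_countable_adapted_cover (𝒜 : LocallyConvexAtlas.{uN, uI, uE} N) (f : C(M, N))
    {B U : Set M} (hB : IsClosed B) (hU : IsOpen U) (hBU : B ⊆ U) :
    ∃ (α : Type uM) (Q C : α → Set M) (i : α → 𝒜.Index), Countable α ∧ LocallyFinite Q ∧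
      (∀ a, IsOpen (Q a)) ∧ (∀ a, IsCompact (closure (Q a))) ∧
      (∀ a, closure (Q a) ⊆ f ⁻¹' (𝒜.chart (i a)).source) ∧ (∀ a, Q a ⊆ U) ∧
      (∀ a, IsCompact (C a)) ∧ (∀ a, C a ⊆ Q a) ∧ B ⊆ ⋃ a, interior (C a) := by
  have hbasis : ∀ x ∈ B, (𝓝 x).HasBasis (fun Q : Set M => x ∈ Q ∧ IsOpen Q ∧
      IsCompact (closure Q) ∧ Q ⊆ U ∧ ∃ i, closure Q ⊆ f ⁻¹' (𝒜.chart i).source) id := by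
    refine fun x hx => ⟨fun t => ⟨fun ht => ?_, ?_⟩⟩
    · obtain ⟨i, hi⟩ := 𝒜.exists_mem_source (f x)
      have ho : IsOpen (interior t ∩ U ∩ f ⁻¹' (𝒜.chart i).source) :=
        (isOpen_interior.inter hU).inter (f.continuous.isOpen_preimage _ (𝒜.chart i).open_source)
      obtain ⟨Q, hQ, hxQ, hQs, hQc⟩ := exists_open_between_and_isCompact_closure
        (isCompact_singleton (x := x)) ho
        (singleton_subset_iff.2 ⟨⟨mem_interior_iff_mem_nhds.2 ht, hBU hx⟩, hi⟩)
      exact ⟨Q, ⟨hxQ rfl, hQ, hQc, fun y hy => (hQs (subset_closure hy)).1.2, i,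
        fun y hy => (hQs hy).2⟩, fun y hy => interior_subset (hQs (subset_closure hy)).1.1⟩
    · rintro ⟨Q, ⟨hxQ, hQ, -⟩, hQt⟩
      exact mem_of_superset (hQ.mem_nhds hxQ) hQt
  obtain ⟨α, c, Q, hQ, hBQ, hfin⟩ :=
    refinement_of_locallyCompact_sigmaCompact_of_nhds_basis_set.{uM, uM} hB hbasis
  choose i hi using fun a => (hQ a).2.2.2.2.2
  obtain ⟨v, hBv, hvo, hvQ⟩ := exists_subset_iUnion_closure_subset hB (fun a => (hQ a).2.2.1)
    (fun x _ => hfin.point_finite x) hBQ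
  refine ⟨α, Q, fun a => closure (v a), i,
    countable_univ_iff.1 (hfin.countable_univ fun a => ⟨c a, (hQ a).2.1⟩), hfin,
    fun a => (hQ a).2.2.1, fun a => (hQ a).2.2.2.1, hi, fun a => (hQ a).2.2.2.2.1,
    fun a => (hQ a).2.2.2.1.of_isClosed_subset isClosed_closure
      (closure_mono (subset_closure.trans (hvQ a))), hvQ, hBv.trans (iUnion_mono fun a => ?_)⟩
  exact interior_maximal subset_closure (hvo a)

end Cover

/-! ### Infinite concatenation of smoothing steps -/

section Concatenation

variable {d : ℕ} {M : Type uM} [TopologicalSpace M] [ChartedSpace (EuclideanQuadrant d) M]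
  {N : Type uN} [TopologicalSpace N]

/-- A homotopy `G` that starts at `f`, is stationary outside `U` and after the time `τ < 1`, stays
in `V` (in terms of graphs), and ends at a map that is smooth on `W`. -/
structure IsPartialSmoothing (𝒜 : LocallyConvexAtlas.{uN, uI, uE} N) (f : C(M, N))
    (V : Set (M × N)) (U : Set M) (G : C(unitInterval × M, N)) (τ : ℝ) (W : Set M) : Prop where
  nonneg : 0 ≤ τ
  lt_one : τ < 1
  apply_zero : ∀ x, G (0, x) = f x
  eq_off : ∀ t, ∀ x ∉ U, G (t, x) = f x
  stationary : ∀ t : unitInterval, τ ≤ t → ∀ x, G (t, x) = G (1, x)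
  mem : ∀ t x, (x, G (t, x)) ∈ V
  isOpen : IsOpen W
  smooth : ∀ g : C(M, N), (∀ x, g x = G (1, x)) → SmoothOnOpen d 𝒜 g W

variable {𝒜 : LocallyConvexAtlas.{uN, uI, uE} N} {f : C(M, N)} {V : Set (M × N)} {U : Set M}

/-- A smoothing step is appended to a partial smoothing, in the time from `τ` to the midpoint of
`τ` and `1`. -/
lemma IsPartialSmoothing.exists_extension [T2Space M] [SigmaCompactSpace M]
    [IsManifold (modelWithCornersEuclideanQuadrant d) ∞ M] (hV : IsOpen V)
    {G : C(unitInterval × M, N)} {τ : ℝ} {W : Set M}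
    (h : IsPartialSmoothing (d := d) 𝒜 f V U G τ W) (i : 𝒜.Index) {C Q : Set M} (hC : IsCompact C)
    (hQ : IsOpen Q) (hCQ : C ⊆ Q) (hQc : IsCompact (closure Q)) (hQU : Q ⊆ U)
    (hVi : ∀ x ∈ closure Q, ∀ y, (x, y) ∈ V → y ∈ (𝒜.chart i).source) :
    ∃ G' τ', IsPartialSmoothing (d := d) 𝒜 f V U G' τ' (W ∪ interior C) ∧
      ∀ t, ∀ x ∉ Q, G' (t, x) = G (t, x) := by
  let f₁ : C(M, N) := ⟨fun x => G (1, x), by fun_prop⟩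
  obtain ⟨F, hF0, hFQ, hFV, hFs⟩ := exists_smoothing_step f₁ hV (h.mem 1) h.isOpen
    (h.smooth f₁ fun _ => rfl) i hC hQ hCQ hQc fun x hx => hVi x hx _ (h.mem 1 x)
  have hτ : 0 < (1 - τ) / 2 := by linarith [h.lt_one]
  let σ : unitInterval → unitInterval := fun t =>
    projIcc 0 1 zero_le_one (((t : ℝ) - τ) / ((1 - τ) / 2))
  have hσ : Continuous σ := continuous_projIcc.comp (by fun_prop)
  have hσ0 : ∀ t : unitInterval, (t : ℝ) ≤ τ → σ t = 0 := fun t ht =>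
    projIcc_of_le_left _ (div_nonpos_of_nonpos_of_nonneg (by linarith) hτ.le)
  have hσ1 : ∀ t : unitInterval, (1 + τ) / 2 ≤ t → σ t = 1 := fun t ht =>
    projIcc_of_right_le _ ((one_le_div hτ).2 (by linarith))
  let Φ : unitInterval × M → N := fun z => if (z.1 : ℝ) ≤ τ then G z else F (σ z.1, z.2)
  have hΦc : Continuous Φ := by
    refine Continuous.if_le G.continuous (F.continuous.comp (by fun_prop)) (by fun_prop)
      continuous_const ?_
    rintro ⟨t, x⟩ htx
    have htx : (t : ℝ) = τ := htx
    simp only [hσ0 t htx.le]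
    rw [hF0]
    exact h.stationary t htx.ge x
  have hΦl : ∀ (t : unitInterval) x, (t : ℝ) ≤ τ → Φ (t, x) = G (t, x) := fun t x ht => if_pos ht
  have hΦr : ∀ (t : unitInterval) x, ¬ (t : ℝ) ≤ τ → Φ (t, x) = F (σ t, x) := fun t x ht => if_neg ht
  have hΦQ : ∀ t, ∀ x ∉ Q, Φ (t, x) = G (t, x) := fun t x hx => by
    by_cases ht : (t : ℝ) ≤ τ
    · exact hΦl t x ht
    · rw [hΦr t x ht, hFQ _ x hx]
      exact (h.stationary t (not_le.1 ht).le x).symm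
  have hΦ1 : ∀ t : unitInterval, (1 + τ) / 2 ≤ t → ∀ x, Φ (t, x) = F (1, x) := fun t ht x => by
    rw [hΦr t x (by linarith [h.lt_one]), hσ1 t ht]
  have hone : (1 + τ) / 2 ≤ ((1 : unitInterval) : ℝ) := by
    rw [Icc.coe_one]; linarith [h.lt_one]
  refine ⟨⟨Φ, hΦc⟩, (1 + τ) / 2, ⟨by linarith [h.nonneg], by linarith [h.lt_one], fun x => ?_,
    fun t x hx => ?_, fun t ht x => ?_, fun t x => ?_, h.isOpen.union isOpen_interior,
    fun g hg => hFs g fun x => (hg x).trans (hΦ1 1 hone x)⟩, hΦQ⟩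
  · exact (hΦl 0 x (by simpa using h.nonneg)).trans (h.apply_zero x)
  · exact (hΦQ t x fun hxQ => hx (hQU hxQ)).trans (h.eq_off t x hx)
  · exact (hΦ1 t ht x).trans (hΦ1 1 hone x).symm
  · change (x, Φ (t, x)) ∈ V
    by_cases ht : (t : ℝ) ≤ τ
    · rw [hΦl t x ht]; exact h.mem t x
    · rw [hΦr t x ht]; exact hFV _ x

/-- A sequence of homotopies that is locally eventually constant has a limit. -/
lemma exists_limit_of_locally_eventually_const {T : Type*} [TopologicalSpace T]
    (G : ℕ → C(T × M, N))
    (hG : ∀ x, ∃ O ∈ 𝓝 x, ∃ m, ∀ n ≥ m, ∀ t, ∀ y ∈ O, G n (t, y) = G m (t, y)) :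
    ∃ H : C(T × M, N), ∀ x, ∃ O ∈ 𝓝 x, ∃ m, ∀ n ≥ m, ∀ t, ∀ y ∈ O, H (t, y) = G n (t, y) := by
  choose O hO m hm using hG
  have key : ∀ x, ∀ n ≥ m x, ∀ t, ∀ y ∈ O x, G (m y) (t, y) = G n (t, y) := by
    intro x n hn t y hy
    rw [hm x n hn t y hy, ← hm x (max (m x) (m y)) (le_max_left _ _) t y hy,
      hm y (max (m x) (m y)) (le_max_right _ _) t y (mem_of_mem_nhds (hO y))]
  refine ⟨⟨fun z => G (m z.2) z, continuous_iff_continuousAt.2 fun ⟨t, x⟩ => ?_⟩,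
    fun x => ⟨O x, hO x, m x, key x⟩⟩
  refine (G (m x)).continuous.continuousAt.congr ?_
  filter_upwards [continuous_snd.continuousAt.preimage_mem_nhds (hO x)] with z hz
  exact (key x (m x) le_rfl z.1 z.2 hz).symm

/-- Smoothing near a closed set `B ⊆ U` by a homotopy that is stationary outside `U`. -/
lemma exists_smoothing_homotopy [T2Space M] [SigmaCompactSpace M]
    [IsManifold (modelWithCornersEuclideanQuadrant d) ∞ M] (hV : IsOpen V)
    (hf : ∀ x, (x, f x) ∈ V) {W : Set M} (hW : IsOpen W) (hfW : SmoothOnOpen d 𝒜 f W)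
    {B : Set M} (hB : IsClosed B) (hU : IsOpen U) (hBU : B ⊆ U) :
    ∃ H : C(unitInterval × M, N), (∀ x, H (0, x) = f x) ∧ (∀ t, ∀ x ∉ U, H (t, x) = f x) ∧
      (∀ t x, (x, H (t, x)) ∈ V) ∧ ∃ W', IsOpen W' ∧ W ∪ B ⊆ W' ∧
        ∀ g : C(M, N), (∀ x, g x = H (1, x)) → SmoothOnOpen d 𝒜 g W' := by
  classical
  have : LocallyCompactSpace (EuclideanQuadrant d) :=
    (modelWithCornersEuclideanQuadrant d).locallyCompactSpace
  have : LocallyCompactSpace M := ChartedSpace.locallyCompactSpace (EuclideanQuadrant d) M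
  obtain ⟨α, Q, C, i, hα, hfin, hQ, hQc, hQi, hQU, hC, hCQ, hBC⟩ :=
    exists_countable_adapted_cover 𝒜 f hB hU hBU
  obtain ⟨e, he⟩ := exists_injective_nat α
  -- Maps with graph in `V₁` still map the closure of `Q a` into the domain of the chart `i a`.
  let bad : α → Set (M × N) := fun a => closure (Q a) ×ˢ (𝒜.chart (i a)).sourceᶜ
  have hbad : IsClosed (⋃ a, bad a) := by
    refine LocallyFinite.isClosed_iUnion ?_ fun a =>
      isClosed_closure.prod (𝒜.chart (i a)).open_source.isClosed_compl
    exact (hfin.closure.preimage_continuous (g := (Prod.fst : M × N → M)) continuous_fst).subset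
      fun a z hz => hz.1
  let V₁ : Set (M × N) := V ∩ (⋃ a, bad a)ᶜ
  have hV₁ : IsOpen V₁ := hV.inter hbad.isOpen_compl
  have hV₁i : ∀ a, ∀ x ∈ closure (Q a), ∀ y, (x, y) ∈ V₁ → y ∈ (𝒜.chart (i a)).source :=
    fun a x hx y hy => by
      by_contra hn
      exact hy.2 (mem_iUnion.2 ⟨a, hx, hn⟩)
  have hf₁ : ∀ x, (x, f x) ∈ V₁ := fun x => ⟨hf x, fun hx => by
    obtain ⟨a, ha, hn⟩ := mem_iUnion.1 hx
    exact hn (hQi a ha)⟩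
  -- A stage of the construction is a homotopy, its final time and the set where its end is smooth.
  let P : C(unitInterval × M, N) × ℝ × Set M → Prop := fun s =>
    IsPartialSmoothing (d := d) 𝒜 f V₁ U s.1 s.2.1 s.2.2
  have hstep : ∀ (n : ℕ) (s : {s // P s}), ∃ s' : {s // P s}, s.1.2.2 ⊆ s'.1.2.2 ∧
      (∀ a, e a = n → interior (C a) ⊆ s'.1.2.2) ∧
      ∀ t x, (∀ a, e a = n → x ∉ Q a) → s'.1.1 (t, x) = s.1.1 (t, x) := by
    rintro n ⟨⟨G, τ, W⟩, hs⟩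
    by_cases hn : ∃ a, e a = n
    · obtain ⟨a, rfl⟩ := hn
      obtain ⟨G', τ', h', heq⟩ := hs.exists_extension hV₁ (i a) (hC a) (hQ a) (hCQ a) (hQc a)
        (hQU a) (hV₁i a)
      refine ⟨⟨⟨G', τ', _⟩, h'⟩, subset_union_left, fun b hb => ?_,
        fun t x hx => heq t x (hx a rfl)⟩
      rw [he hb]
      exact subset_union_right
    · exact ⟨⟨⟨G, τ, W⟩, hs⟩, subset_rfl, fun a ha => (hn ⟨a, ha⟩).elim, fun _ _ _ => rfl⟩
  choose next hnextW hnextC hnextQ using hstep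
  have hs₀ : P (⟨fun z => f z.2, by fun_prop⟩, 0, W) :=
    ⟨le_rfl, zero_lt_one, fun _ => rfl, fun _ _ _ => rfl, fun _ _ _ => rfl, fun _ x => hf₁ x, hW,
      fun g hg => hfW.congr fun x _ => hg x⟩
  let s : ℕ → {s // P s} := fun n => Nat.rec ⟨_, hs₀⟩ next n
  have hs1 : ∀ n, s (n + 1) = next n (s n) := fun _ => rfl
  have hmono : Monotone fun n => (s n).1.2.2 := monotone_nat_of_le_succ fun n => by
    rw [hs1]; exact hnextW n (s n)
  have hloc : ∀ x, ∃ O ∈ 𝓝 x, ∃ m, ∀ n ≥ m, ∀ t, ∀ y ∈ O,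
      (s n).1.1 (t, y) = (s m).1.1 (t, y) := by
    intro x
    obtain ⟨O, hO, hOfin⟩ := hfin x
    obtain ⟨m, hm⟩ := (hOfin.image e).bddAbove
    refine ⟨O, hO, m + 1, fun n hn t y hy => ?_⟩
    induction n, hn using Nat.le_induction with
    | base => rfl
    | succ n hn ih =>
      rw [← ih, hs1]
      refine hnextQ n (s n) t y fun a ha hya => ?_
      have := hm ⟨a, ⟨y, hya, hy⟩, ha⟩
      omega
  obtain ⟨H, hH⟩ := exists_limit_of_locally_eventually_const (fun n => (s n).1.1) hloc
  have hpt : ∀ x, ∃ n, ∀ t, H (t, x) = (s n).1.1 (t, x) := fun x => by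
    obtain ⟨O, hO, m, hm⟩ := hH x
    exact ⟨m, fun t => hm m le_rfl t x (mem_of_mem_nhds hO)⟩
  have hWo : IsOpen (⋃ n, (s n).1.2.2) := isOpen_iUnion fun n => (s n).2.isOpen
  refine ⟨H, fun x => ?_, fun t x hx => ?_, fun t x => ?_, ⋃ n, (s n).1.2.2, hWo,
    union_subset (subset_iUnion (fun n => (s n).1.2.2) 0) fun x hx => ?_, fun g hg => ?_⟩
  · obtain ⟨n, hn⟩ := hpt x
    rw [hn]; exact (s n).2.apply_zero x
  · obtain ⟨n, hn⟩ := hpt x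
    rw [hn]; exact (s n).2.eq_off t x hx
  · obtain ⟨n, hn⟩ := hpt x
    rw [hn]; exact ((s n).2.mem t x).1
  · obtain ⟨a, ha⟩ := mem_iUnion.1 (hBC hx)
    exact mem_iUnion.2 ⟨e a + 1, hnextC (e a) (s (e a)) a rfl ha⟩
  · refine smoothOnOpen_of_locally hWo fun x hx => ?_
    obtain ⟨k, hk⟩ := mem_iUnion.1 hx
    obtain ⟨O, hO, m, hm⟩ := hH x
    refine ⟨interior O ∩ (s k).1.2.2, isOpen_interior.inter (s k).2.isOpen,
      ⟨mem_interior_iff_mem_nhds.2 hO, hk⟩, ?_⟩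
    let G : C(unitInterval × M, N) := (s (max k m)).1.1
    have h1 := (s (max k m)).2.smooth ⟨fun x => G (1, x), by fun_prop⟩
      fun _ => rfl
    refine (h1.mono (inter_subset_right.trans (hmono (le_max_left k m)))).congr fun y hy => ?_
    rw [hg]
    exact hm _ (le_max_right _ _) 1 y (interior_subset hy.1)

end Concatenation

/-! ### The two topologies -/

section Topologies

variable {M : Type uM} [TopologicalSpace M] {N : Type uN} [TopologicalSpace N]

lemma exists_isOpen_graph_subset {O : Set C(M, N)} (hO : IsOpen[graphTopology M N] O) {f : C(M, N)}
    (hf : f ∈ O) : ∃ V : Set (M × N), IsOpen V ∧ (∀ x, (x, f x) ∈ V) ∧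
      ∀ g : C(M, N), (∀ x, (x, g x) ∈ V) → g ∈ O := by
  induction hO with
  | basic S hS =>
    obtain ⟨V, hV, rfl⟩ := hS
    exact ⟨V, hV, hf, fun g hg => hg⟩
  | univ => exact ⟨univ, isOpen_univ, fun _ => mem_univ _, fun _ _ => mem_univ _⟩
  | inter S T _ _ ihS ihT =>
    obtain ⟨V, hV, hfV, hVS⟩ := ihS hf.1
    obtain ⟨V', hV', hfV', hVT⟩ := ihT hf.2
    exact ⟨V ∩ V', hV.inter hV', fun x => ⟨hfV x, hfV' x⟩,
      fun g hg => ⟨hVS g fun x => (hg x).1, hVT g fun x => (hg x).2⟩⟩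
  | sUnion 𝒮 _ ih =>
    obtain ⟨S, hS, hfS⟩ := hf
    obtain ⟨V, hV, hfV, hVS⟩ := ih S hS hfS
    exact ⟨V, hV, hfV, fun g hg => ⟨S, hS, hVS g hg⟩⟩

lemma graphTopology_le_compactOpen [T2Space M] :
    graphTopology M N ≤ ContinuousMap.compactOpen := by
  refine le_generateFrom ?_
  rintro _ ⟨K, hK, W, hW, rfl⟩
  refine TopologicalSpace.isOpen_generateFrom_of_mem ⟨Kᶜ ×ˢ univ ∪ univ ×ˢ W,
    (hK.isClosed.isOpen_compl.prod isOpen_univ).union (isOpen_univ.prod hW), ?_⟩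
  ext f
  simp only [mem_ofPred_eq, mem_union, mem_prod, mem_compl_iff, mem_univ, and_true, true_and,
    MapsTo]
  exact forall_congr' fun x => by tauto

end Topologies

/-! ### Approximation and density -/

theorem mainTheorem2 (d : ℕ)
    {M : Type uM} [TopologicalSpace M] [T2Space M] [ParacompactSpace M] [ConnectedSpace M]
    [ChartedSpace (EuclideanQuadrant d) M]
    [IsManifold (modelWithCornersEuclideanQuadrant d) ∞ M]
    {N : Type uN} [TopologicalSpace N] [T2Space N]
    (𝒜 : LocallyConvexAtlas.{uN, uI, uE} N) :
    -- approximation in the graph topology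
    (∀ (f : C(M, N)) (A U : Set M), IsClosed A → IsOpen U → SmoothNear d 𝒜 f (A \ U) →
      ∀ O : Set C(M, N), IsOpen[graphTopology M N] O → f ∈ O →
        ∃ g ∈ O, ContinuousMap.HomotopicWith f g (fun h => h ∈ O) ∧
          SmoothNear d 𝒜 g A ∧ ∀ x ∉ U, g x = f x) ∧
    (@Dense C(M, N) (graphTopology M N) (smoothMaps d 𝒜)) ∧
    -- approximation in the compact-open topology
    (∀ (f : C(M, N)) (A U : Set M), IsClosed A → IsOpen U → SmoothNear d 𝒜 f (A \ U) →
      ∀ O : Set C(M, N), IsOpen[ContinuousMap.compactOpen] O → f ∈ O →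
        ∃ g ∈ O, ContinuousMap.HomotopicWith f g (fun h => h ∈ O) ∧
          SmoothNear d 𝒜 g A ∧ ∀ x ∉ U, g x = f x) ∧
    (@Dense C(M, N) ContinuousMap.compactOpen (smoothMaps d 𝒜)) := by
  have : LocallyCompactSpace (EuclideanQuadrant d) :=
    (modelWithCornersEuclideanQuadrant d).locallyCompactSpace
  have : LocallyCompactSpace M := ChartedSpace.locallyCompactSpace (EuclideanQuadrant d) M
  have : SigmaCompactSpace M := sigmaCompactSpace_of_connected_paracompact M
  have key : ∀ (f : C(M, N)) (A U : Set M), IsClosed A → IsOpen U → SmoothNear d 𝒜 f (A \ U) →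
      ∀ O : Set C(M, N), IsOpen[graphTopology M N] O → f ∈ O →
        ∃ g ∈ O, ContinuousMap.HomotopicWith f g (fun h => h ∈ O) ∧
          SmoothNear d 𝒜 g A ∧ ∀ x ∉ U, g x = f x := by
    rintro f A U hA hU ⟨W, hW, hAW, hfW⟩ O hO hfO
    obtain ⟨V, hV, hfV, hVO⟩ := exists_isOpen_graph_subset hO hfO
    obtain ⟨H, hH0, hHU, hHV, W', hW', hWW', hHs⟩ := exists_smoothing_homotopy hV hfV hW hfW
      -- Near `A ∩ W` the map `f` is smooth already; what is left of `A` lies in `U`.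
      (hA.sdiff hW) hU fun x hx => by
        by_contra hxU
        exact hx.2 (hAW ⟨hx.1, hxU⟩)
    refine ⟨⟨fun x => H (1, x), by fun_prop⟩, hVO _ fun x => hHV 1 x,
      ⟨{ toContinuousMap := H
         map_zero_left := hH0
         map_one_left := fun _ => rfl
         prop' := fun t => hVO _ fun x => hHV t x }⟩,
      ⟨W', hW', fun x hx => hWW' ?_, hHs _ fun _ => rfl⟩, fun x hx => hHU 1 x hx⟩
    by_cases hxW : x ∈ W
    · exact Or.inl hxW
    · exact Or.inr ⟨hx, hxW⟩
  have dense : @Dense C(M, N) (graphTopology M N) (smoothMaps d 𝒜) := by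
    let _ := graphTopology M N
    refine fun f => mem_closure_iff.2 fun O hO hfO => ?_
    obtain ⟨g, hgO, -, ⟨W, -, hW, hgW⟩, -⟩ := key f univ univ isClosed_univ isOpen_univ
      ⟨∅, isOpen_empty, by simp, smoothOnOpen_empty f⟩ O hO hfO
    exact ⟨g, hgO, hgW.mono hW⟩
  have hle := graphTopology_le_compactOpen (M := M) (N := N)
  refine ⟨key, dense, fun f A U hA hU hf O hO => key f A U hA hU hf O (hle O hO), fun f => ?_⟩
  refine (@mem_closure_iff _ ContinuousMap.compactOpen _ _).2 fun O hO hfO => ?_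
  exact (@mem_closure_iff _ (graphTopology M N) _ _).1 (dense f) O (hle O hO) hfO
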